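/- Let $G=(V,E)$ be a $d$-regular simple graph on $n$ vertices, $d\ge 1$, with its edges numbered $1,\dots,|E|$ in an arbitrary way, and let $\lambda=\max(|\lambda_2|,|\lambda_n|)$, where $\lambda_2$ and $\lambda_n$ are the second largest and the smallest eigenvalue of its adjacency matrix. Let $C\subset\{0,1\}^d$ be a binary linear code of rank $k_0$ and distance $\Delta_0$. Place a qubit $v_e$ for every vertex $v$ and every edge $e$ incident to $v$ ($nd$ qubits in total). For $v\in V$ let $P_v=\sum_{c\in C}|c\rangle\langle c|$ act on the $d$ qubits at $v$, where the $i$-th bit of $c$ belongs to the $i$-th edge incident to $v$ in the order of the numbering. For a real $\delta\neq 0$ let $Q_v=P_v+\delta\mathbb{1}$. For an edge $e=(v,v')$ let $$g_e=(Q_v\otimes Q_{v'})^{-1}\bigl(\mathbb{1}-\Pi_e\bigr)(Q_v\otimes Q_{v'})^{-1},$$ where $\Pi_e$ is the orthogonal projector onto $|00\rangle+|11\rangle$ on the two qubits $v_e,v'_e$, and let $h_e$ be the orthogonal projector onto the image of $g_e$. Let $H=\sum_{e\in E}h_e$, and let $H_1=\sum_{e\in E_1}h_e$, where $E_1\subset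 E$ is obtained by removing at most $\varepsilon|E|$ edges. Assume $$\varepsilon\le\frac{1}{20000\,d^2},\qquad \varepsilon\le\frac{\Delta_0^2}{300\,d^4},\qquad \Delta_0\ge 4\lambda,\qquad k_0\ge 0.55\,d,\qquad \delta^2\le\frac{2^{-d}}{10000\,n}.$$ Let $|\rho\rangle=U|0\rangle^{\otimes m}$ be a state on $m\ge nd$ qubits that include the $nd$ qubits above, where $U$ is a quantum circuit of depth $t$ (a sequence of $t$ layers, each consisting of one- and two-qubit unitary gates on disjoint sets of qubits, without geometric restriction). Suppose that $\frac12\bigl\||\Gamma\rangle\langle\Gamma|-|\rho\rangle\langle\rho|\bigr\|_1\le 0.1$ for some pure state $|\Gamma\rangle$ on the $m$ qubits which is a ground state of $H_1$, i.e. whose reduced state on the $nd$ qubits is supported on the ground space of $H_1$. Then $$t=\Omega\Bigl(\log\frac{n\Delta_0^4}{d^3}\Bigr),$$ that is, there are absolute constants $c>0$ and $X_0$ such that in every such situation with $n\Delta_0^4/d^3\ge X_0$ one has $t\ge c\,\log\frac{n\Delta_0^4}{d^3}$. -/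

import Mathlib

noncomputable section

namespace TannerNLTS

/-- A classical bit. Computational basis states of a finite set `Q` of qubits are the
functions `Q → Bit`, and (pure) states are vectors `(Q → Bit) → ℂ`. -/
abbrev Bit : Type := ZMod 2

/-! ### States, operators and norms on finitely many qubits -/

section Qubits

variable {Q : Type} [Fintype Q] [DecidableEq Q]

/-- The operator `g ⊗ 𝟙`, where `g` acts on the qubits in `S` and `𝟙` on the other ones. -/
def onQubits (S : Finset Q) (g : Matrix (S → Bit) (S → Bit) ℂ) :
    Matrix (Q → Bit) (Q → Bit) ℂ :=
  fun x y => if ∀ q, q ∉ S → x q = y q then g (fun q => x q) (fun q => y q) else 0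

/-- The all-zero product state `|0…0⟩`. -/
def zeroState : (Q → Bit) → ℂ := Pi.single 0 1

/-- The rank-one operator `|ψ⟩⟨ψ|`. -/
def ketbra {ι : Type} (ψ : ι → ℂ) : Matrix ι ι ℂ := Matrix.vecMulVec ψ (star ψ)

/-- The trace norm `‖A‖₁`: the sum of the singular values. -/
def traceNorm {ι : Type} [Fintype ι] [DecidableEq ι] (A : Matrix ι ι ℂ) : ℝ :=
  ∑ i ∈ Finset.range (Fintype.card ι), (Matrix.toEuclideanLin A).singularValues i

/-- The trace distance `½ ‖|φ⟩⟨φ| - |ψ⟩⟨ψ|‖₁` between two pure states. -/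
def traceDist {ι : Type} [Fintype ι] [DecidableEq ι] (φ ψ : ι → ℂ) : ℝ :=
  (1 / 2) * traceNorm (ketbra φ - ketbra ψ)

/-- The orthogonal projector onto the image of `A`. -/
def imageProj {ι : Type} [Fintype ι] [DecidableEq ι] (A : Matrix ι ι ℂ) : Matrix ι ι ℂ :=
  Matrix.toEuclideanLin.symm
    (LinearMap.range (Matrix.toEuclideanLin A)).starProjection.toLinearMap

/-- The smallest eigenvalue of a Hermitian operator. -/
def groundEnergy {ι : Type} [Fintype ι] [DecidableEq ι] (H : Matrix ι ι ℂ) : ℝ :=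
  sInf (spectrum ℝ H)

/-- The ground space: the eigenspace of the smallest eigenvalue. -/
def groundSpace {ι : Type} [Fintype ι] [DecidableEq ι] (H : Matrix ι ι ℂ) :
    Submodule ℂ (ι → ℂ) :=
  Module.End.eigenspace (Matrix.toLin' H) (groundEnergy H : ℂ)

/-- The reduced density operator on `Q` of a pure state on `Q` together with ancillas `A`
(the partial trace of `|Γ⟩⟨Γ|` over the qubits in `A`). -/
def reducedState {A : Type} [Fintype A] [DecidableEq A] (Γ : (Q ⊕ A → Bit) → ℂ) :
    Matrix (Q → Bit) (Q → Bit) ℂ :=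
  fun x y => ∑ w : A → Bit, Γ (Sum.elim x w) * star (Γ (Sum.elim y w))

/-- `Γ` is a normalized pure state on `Q` and ancillas `A`, whose reduced state on `Q` is
supported on the ground space of the Hamiltonian `H` on `Q`. -/
def IsGroundState {A : Type} [Fintype A] [DecidableEq A] (H : Matrix (Q → Bit) (Q → Bit) ℂ)
    (Γ : (Q ⊕ A → Bit) → ℂ) : Prop :=
  star Γ ⬝ᵥ Γ = 1 ∧ LinearMap.range (Matrix.toLin' (reducedState Γ)) ≤ groundSpace H

end Qubits

/-! ### Quantum circuits -/

/-- A gate: a unitary acting on at most two of the qubits in `Q`. -/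
structure Gate (Q : Type) [DecidableEq Q] where
  /-- The qubits on which the gate acts. -/
  supp : Finset Q
  card_le : supp.card ≤ 2
  /-- The unitary applied to these qubits. -/
  mat : Matrix (supp → Bit) (supp → Bit) ℂ
  star_mul : mat.conjTranspose * mat = 1

/-- A layer: finitely many gates on pairwise disjoint sets of qubits. -/
structure Layer (Q : Type) [DecidableEq Q] where
  gates : List (Gate Q)
  disj : gates.Pairwise fun g g' => Disjoint g.supp g'.supp

/-- A quantum circuit: a sequence of layers. There is no restriction on which pairs of qubits
may interact. -/
abbrev Circuit (Q : Type) [DecidableEq Q] : Type := List (Layer Q)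

section Circuits

variable {Q : Type} [Fintype Q] [DecidableEq Q]

/-- The unitary implemented by a layer. -/
def Layer.toMatrix (L : Layer Q) : Matrix (Q → Bit) (Q → Bit) ℂ :=
  (L.gates.map fun g => onQubits g.supp g.mat).prod

/-- The unitary implemented by a circuit (the last layer of the list is applied first). -/
def Circuit.toMatrix (U : Circuit Q) : Matrix (Q → Bit) (Q → Bit) ℂ :=
  (List.map Layer.toMatrix U).prod

/-- The depth of a circuit: its number of layers. -/
def Circuit.depth {Q : Type} [DecidableEq Q] (U : Circuit Q) : ℕ := List.length U

/-- The state `U |0…0⟩`. -/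
def Circuit.output (U : Circuit Q) : (Q → Bit) → ℂ :=
  Matrix.mulVec (Circuit.toMatrix U) zeroState

end Circuits

/-! ### Classical codes and graphs -/

/-- The distance of a binary linear code: the least Hamming distance between two different
codewords. -/
def codeDist {d : ℕ} (C : Submodule Bit (Fin d → Bit)) : ℕ :=
  sInf {w | ∃ x ∈ C, ∃ y ∈ C, x ≠ y ∧ hammingDist x y = w}

section Graph

variable {V : Type} [Fintype V] [DecidableEq V] (G : SimpleGraph V) [DecidableRel G.Adj]

/-- `max(|λ₂|, |λₙ|)`, where `λ₁ ≥ λ₂ ≥ … ≥ λₙ` are the eigenvalues of the adjacency matrix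
(and `0` for a graph with fewer than two vertices). -/
def secondEigenvalue : ℝ :=
  if h : 2 ≤ Fintype.card V then
    max |(G.isHermitian_adjMatrix ℝ).eigenvalues₀ ⟨1, by omega⟩|
      |(G.isHermitian_adjMatrix ℝ).eigenvalues₀ ⟨Fintype.card V - 1, by omega⟩|
  else 0

/-- A numbering of the edges of `G`. -/
abbrev EdgeNumbering : Type := G.edgeSet ≃ Fin (Fintype.card G.edgeSet)

/-- The edges incident to `v`. -/
def incidentEdges (v : V) : Finset G.edgeSet :=
  Finset.univ.filter fun e => v ∈ (e : Sym2 V)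

theorem card_incidentEdges {d : ℕ} (hG : G.IsRegularOfDegree d) (v : V) :
    (incidentEdges G v).card = d := by
  rw [← hG v, ← G.card_incidenceFinset_eq_degree v]
  refine Finset.card_bij (fun e _ => (e : Sym2 V)) ?_ ?_ ?_
  · intro e he
    rw [SimpleGraph.mem_incidenceFinset]
    exact ⟨e.2, (Finset.mem_filter.1 he).2⟩
  · intro e _ e' _ h
    exact Subtype.ext h
  · intro e he
    rw [SimpleGraph.mem_incidenceFinset] at he
    exact ⟨⟨e, he.1⟩, Finset.mem_filter.2 ⟨Finset.mem_univ _, he.2⟩, rfl⟩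

variable {G} in
/-- The `i`-th edge incident to `v`, in the order given by the numbering. -/
def edgeAt (num : EdgeNumbering G) {d : ℕ} (hG : G.IsRegularOfDegree d) (v : V) (i : Fin d) :
    G.edgeSet :=
  num.symm (((incidentEdges G v).map num.toEmbedding).orderEmbOfFin
    (by rw [Finset.card_map, card_incidentEdges G hG v]) i)

variable {G} in
theorem mem_edgeAt (num : EdgeNumbering G) {d : ℕ} (hG : G.IsRegularOfDegree d) (v : V)
    (i : Fin d) : v ∈ (edgeAt num hG v i : Sym2 V) := by
  have h := Finset.orderEmbOfFin_mem ((incidentEdges G v).map num.toEmbedding)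
    (by rw [Finset.card_map, card_incidentEdges G hG v] : _ = d) i
  obtain ⟨e, he, he'⟩ := Finset.mem_map.1 h
  have : edgeAt num hG v i = e := by
    rw [edgeAt, ← he']
    exact num.symm_apply_apply e
  rw [this]
  exact (Finset.mem_filter.1 he).2

/-! ### The Hamiltonian -/

/-- The qubits `v_e`: one for each vertex `v` and each edge `e` incident to `v`. -/
abbrev Qubit : Type := {p : V × G.edgeSet // p.1 ∈ (p.2 : Sym2 V)}

/-- The two qubits `v_e`, `v'_e` that belong to the edge `e = {v, v'}`. -/
def edgeQubits (e : G.edgeSet) : Finset (Qubit G) :=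
  Finset.univ.filter fun p => p.1.2 = e

/-- The unnormalized vector `|EPR⟩ = |00⟩ + |11⟩` on the two qubits of the edge `e`. -/
def eprVec (e : G.edgeSet) : (edgeQubits G e → Bit) → ℂ :=
  Pi.single 0 1 + Pi.single 1 1

/-- The orthogonal projector `½ |EPR⟩⟨EPR|` onto the EPR pair of the edge `e`, acting on all
qubits. -/
def eprProj (e : G.edgeSet) : Matrix (Qubit G → Bit) (Qubit G → Bit) ℂ :=
  onQubits (edgeQubits G e) ((1 / 2 : ℂ) • ketbra (eprVec G e))

variable {G}
variable (num : EdgeNumbering G) {d : ℕ} (hG : G.IsRegularOfDegree d)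
  (C : Submodule Bit (Fin d → Bit)) (δ : ℝ)

/-- The string of the bits carried by the qubits at `v`, in the order given by the numbering
of the edges. -/
def localString (z : Qubit G → Bit) (v : V) : Fin d → Bit :=
  fun i => z ⟨(v, edgeAt num hG v i), mem_edgeAt num hG v i⟩

open Classical in
/-- The projector `P_v`: on the basis states whose string at `v` is a word of `C`. -/
def projP (v : V) : Matrix (Qubit G → Bit) (Qubit G → Bit) ℂ :=
  Matrix.diagonal fun z => if localString num hG z v ∈ C then 1 else 0

/-- `Q_v = P_v + δ 𝟙`. -/
def opQ (v : V) : Matrix (Qubit G → Bit) (Qubit G → Bit) ℂ :=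
  projP num hG C v + (δ : ℂ) • 1

theorem opQ_comm (v v' : V) :
    opQ num hG C δ v * opQ num hG C δ v' = opQ num hG C δ v' * opQ num hG C δ v := by
  have h : Commute (projP num hG C v) (projP num hG C v') := by
    rw [commute_iff_eq, projP, projP, Matrix.diagonal_mul_diagonal, Matrix.diagonal_mul_diagonal]
    congr 1
    funext z
    exact mul_comm _ _
  exact ((h.add_right ((Commute.one_right _).smul_right _)).add_left
    (((Commute.one_left _).smul_left _)))

/-- The operator `Q_v ⊗ Q_v'` for the edge `e = {v, v'}`, acting on all qubits: the product of
the commuting operators `Q_v` and `Q_v'`. -/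
def opQEdge (e : G.edgeSet) : Matrix (Qubit G → Bit) (Qubit G → Bit) ℂ :=
  Sym2.lift ⟨fun v v' => opQ num hG C δ v * opQ num hG C δ v', opQ_comm num hG C δ⟩
    (e : Sym2 V)

/-- `g_e = (Q_v ⊗ Q_v')⁻¹ (𝟙 - ½ |EPR⟩⟨EPR|) (Q_v ⊗ Q_v')⁻¹`. -/
def opG (e : G.edgeSet) : Matrix (Qubit G → Bit) (Qubit G → Bit) ℂ :=
  (opQEdge num hG C δ e)⁻¹ * (1 - eprProj G e) * (opQEdge num hG C δ e)⁻¹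

/-- The local term `h_e`: the orthogonal projector onto the image of `g_e`. -/
def localTerm (e : G.edgeSet) : Matrix (Qubit G → Bit) (Qubit G → Bit) ℂ :=
  imageProj (opG num hG C δ e)

/-- The Hamiltonian `∑ h_e`, the sum being over the edges in `E₁`. -/
def hamiltonian (E₁ : Finset G.edgeSet) : Matrix (Qubit G → Bit) (Qubit G → Bit) ℂ :=
  ∑ e ∈ E₁, localTerm num hG C δ e

end Graph

end TannerNLTS

end

/-! Measuring a ground state in the computational basis yields two far apart sets of strings, each
of probability nearly one half. The outcomes of a shallow circuit are too concentrated for that.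

Ground states. The product of all `Q_v` is diagonal and invertible. A vector (product of all `Q_v`)
φ is annihilated by `h_e` exactly when φ lives on strings with equal bits on `e` and is invariant
under flipping both bits: the factors at the endpoints of `e` cancel the inverses in `g_e`, and the
other factors do not see the flip (`localTerm_mulVec_eq_zero_iff`). Hence `H₁` is frustration free,
and for every ground state, with any ancillas, the outcome x has probability const · a^(number of
vertices whose string is not in `C`) · μ(x). Here a = (δ/(1+δ))², and μ is supported on strings
constant on the edges of `E₁` and invariant under adding strings that live on these edges
(`IsGroundState.exists_weight`).

Few violations. In a coset of these edge strings, at most |K| 2^(d|B|) strings have violated set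
exactly B, where K is the Tanner code on `E₁`. The whole coset has weight at least |K| a^u, where u
is the number of vertices touched by removed edges. As 2^d a is of order 1/n and u is small, more
than b = nΔ₀²/(100d²) violations have probability at most 1/10 (`sum_violated_gt_le`).

Clusters. The sum of two strings with at most b violations has at most 2b. If t vertices see a
nonzero string of this sum, the code distance and the expander mixing lemma give Δ₀(t - 2b) ≤ dt²/n
+ λt + 2|E₁ᶜ|, so t is at most 0.05 nΔ₀/d or at least 0.7 nΔ₀/d. Being close is therefore an
equivalence relation. The rate of `C` exceeds 1/2, so there is a nonzero Tanner word k; adding k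
preserves probabilities and moves every class to another one. Splitting the classes along this
pairing gives two sets of probability at least 0.45 at Hamming distance at least 0.68 nΔ₀²/d
(`exists_separated_sets`).

Depth. For a circuit of depth t, a 1-Lipschitz function of N measured bits has variance at most N
8^t (`variance_circuit_output_le`): conjugating the circuit away, this is the spectral gap of the
number operator above the all-zero state combined with light cones of size 2^t. For the distance to
one of the two sets, with N = nd, the variance is at least a constant times (nΔ₀²/d)², so 8^t is at
least a constant times nΔ₀⁴/d³. -/

namespace TannerNLTS

/-! ### Locality of operators -/

section Locality

variable {Q : Type} [Fintype Q] [DecidableEq Q]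

theorem onQubits_one (S : Finset Q) : onQubits S (1 : Matrix (S → Bit) (S → Bit) ℂ) = 1 := by
  ext x y
  simp only [onQubits, Matrix.one_apply]
  by_cases h : x = y
  · subst h; simp
  · rw [if_neg h]
    split_ifs with h1 h2
    · exfalso
      apply h
      funext q
      by_cases hq : q ∈ S
      · exact congrFun h2 ⟨q, hq⟩
      · exact h1 q hq
    · rfl
    · rfl

theorem onQubits_conjTranspose (S : Finset Q) (g : Matrix (S → Bit) (S → Bit) ℂ) :
    (onQubits S g).conjTranspose = onQubits S g.conjTranspose := by
  ext x y
  simp only [onQubits, Matrix.conjTranspose_apply]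
  by_cases h : ∀ q, q ∉ S → x q = y q
  · rw [if_pos h, if_pos fun q hq => (h q hq).symm]
  · rw [if_neg h, if_neg fun h' => h fun q hq => (h' q hq).symm, star_zero]

/-- The string that agrees with `w` on `S` and with `x` elsewhere. -/
def glue (S : Finset Q) (w : S → Bit) (x : Q → Bit) : Q → Bit :=
  fun q => if h : q ∈ S then w ⟨q, h⟩ else x q

omit [Fintype Q] in
theorem glue_injective (S : Finset Q) (x : Q → Bit) :
    Function.Injective fun w => glue S w x := by
  intro w w' h
  funext q
  have := congrFun h q.1
  simpa [glue, q.2] using this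

/-- Row x of the operator is supported on the strings that agree with x off `S`, and `glue`
parametrizes these by their restriction to `S`. -/
theorem onQubits_mulVec (S : Finset Q) (g : Matrix (S → Bit) (S → Bit) ℂ) (f : (Q → Bit) → ℂ)
    (x : Q → Bit) :
    (onQubits S g).mulVec f x = ∑ w : S → Bit, g (fun q => x q) w * f (glue S w x) := by
  symm
  refine Fintype.sum_of_injective _ (glue_injective S x) _ _ ?_ ?_
  · intro z hz
    have : ¬ ∀ q, q ∉ S → x q = z q := ?_
    · simp only [onQubits, if_neg this, zero_mul]
    intro h
    apply hz
    refine ⟨fun q => z q, ?_⟩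
    funext q
    by_cases hq : q ∈ S <;> simp [glue, hq, h q]
  · intro w
    have h1 : ∀ q, q ∉ S → x q = glue S w x q := fun q hq => by simp [glue, hq]
    have h2 : (fun q : S => glue S w x q) = w := by
      funext q; simp [glue]
    simp only [onQubits, if_pos h1, h2]

theorem onQubits_mul (S : Finset Q) (g h : Matrix (S → Bit) (S → Bit) ℂ) :
    onQubits S g * onQubits S h = onQubits S (g * h) := by
  ext x y
  have := onQubits_mulVec S g (fun z => onQubits S h z y) x
  rw [Matrix.mul_apply]
  rw [Matrix.mulVec, dotProduct] at this
  rw [this]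
  have h2 : ∀ w, (fun q : S => glue S w x q) = w := by
    intro w; funext q; simp [glue]
  by_cases hxy : ∀ q, q ∉ S → x q = y q
  · have h1 : ∀ w, ∀ q, q ∉ S → glue S w x q = y q := fun w q hq => by simp [glue, hq, hxy q hq]
    simp only [onQubits, if_pos hxy, Matrix.mul_apply, h2]
    exact Finset.sum_congr rfl fun w _ => by rw [if_pos (h1 w)]
  · have h1 : ∀ w, ¬ ∀ q, q ∉ S → glue S w x q = y q := fun w h' =>
      hxy fun q hq => by simpa [glue, hq] using h' q hq
    simp only [onQubits, if_neg hxy, h1, if_false, mul_zero, Finset.sum_const_zero]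

/-- Only one intermediate string contributes to the matrix product: y on `S` and x elsewhere. The
resulting entry is symmetric in the two factors, which yields commutation. -/
theorem onQubits_mul_disjoint_apply {S T : Finset Q} (hST : Disjoint S T)
    (g : Matrix (S → Bit) (S → Bit) ℂ) (h : Matrix (T → Bit) (T → Bit) ℂ) (x y : Q → Bit) :
    (onQubits S g * onQubits T h) x y =
      if ∀ q, q ∉ S → q ∉ T → x q = y q then
        g (fun q => x q) (fun q => y q) * h (fun q => x q) (fun q => y q) else 0 := by
  rw [Matrix.mul_apply,
    Finset.sum_eq_single (fun q => if q ∈ S then y q else x q : Q → Bit)]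
  · have hS : ∀ q : S, (if (q : Q) ∈ S then y q else x q) = y q := fun q => by simp
    have hT : ∀ q : T, (if (q : Q) ∈ S then y q else x q) = x q := fun q => by
      rw [if_neg (Finset.disjoint_right.1 hST q.2)]
    simp only [onQubits, hS, hT]
    rw [if_pos (fun q hq => by rw [if_neg hq])]
    by_cases hxy : ∀ q, q ∉ S → q ∉ T → x q = y q
    · rw [if_pos hxy, if_pos]
      intro q hq
      by_cases hqS : q ∈ S
      · simp [hqS]
      · simp [hqS, hxy q hqS hq]
    · rw [if_neg hxy, if_neg, mul_zero]
      intro h'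
      exact hxy fun q hq hq' => by simpa [hq] using h' q hq'
  · intro z _ hz
    simp only [onQubits]
    split_ifs with h1 h2
    · exfalso
      apply hz
      funext q
      by_cases hq : q ∈ S
      · simp [hq, h2 q (Finset.disjoint_left.1 hST hq)]
      · simp [hq, h1 q hq]
    · simp
    · simp
    · simp
  · simp

theorem onQubits_commute {S T : Finset Q} (hST : Disjoint S T)
    (g : Matrix (S → Bit) (S → Bit) ℂ) (h : Matrix (T → Bit) (T → Bit) ℂ) :
    Commute (onQubits S g) (onQubits T h) := by
  ext x y
  rw [onQubits_mul_disjoint_apply hST, onQubits_mul_disjoint_apply hST.symm]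
  have : (∀ q, q ∉ S → q ∉ T → x q = y q) ↔ (∀ q, q ∉ T → q ∉ S → x q = y q) :=
    forall_congr' fun q => ⟨fun h a b => h b a, fun h a b => h b a⟩
  simp only [this, mul_comm]

/-- `A` commutes with all operators on qubits outside `S`. -/
def IsLocal (S : Finset Q) (A : Matrix (Q → Bit) (Q → Bit) ℂ) : Prop :=
  ∀ (T : Finset Q) (h : Matrix (T → Bit) (T → Bit) ℂ), Disjoint S T → Commute A (onQubits T h)

theorem IsLocal.mono {S S' : Finset Q} {A : Matrix (Q → Bit) (Q → Bit) ℂ} (hA : IsLocal S A)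
    (h : S ⊆ S') : IsLocal S' A :=
  fun T g hT => hA T g (Finset.disjoint_of_subset_left h hT)

/-- A diagonal operator whose entries do not depend on the bits in `S` commutes with the
operators that are local on `S`. -/
theorem IsLocal.commute_diagonal {S : Finset Q} {A : Matrix (Q → Bit) (Q → Bit) ℂ}
    (hA : IsLocal S A) (f : (Q → Bit) → ℂ)
    (hf : ∀ x y : Q → Bit, (∀ q, q ∉ S → x q = y q) → f x = f y) :
    Commute A (Matrix.diagonal f) := by
  have : Matrix.diagonal f =
      onQubits Sᶜ (Matrix.diagonal fun w => f (glue Sᶜ w 0)) := by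
    ext x y
    simp only [onQubits, Matrix.diagonal_apply]
    by_cases hxy : x = y
    · subst hxy
      simp only [if_true, implies_true]
      apply hf
      intro q hq
      simp [glue, hq]
    · rw [if_neg hxy]
      split_ifs with h1 h2
      · exfalso
        apply hxy
        funext q
        by_cases hq : q ∈ S
        · exact h1 q (by simpa using hq)
        · exact congrFun h2 ⟨q, by simpa using hq⟩
      · rfl
      · rfl
  rw [this]
  exact hA _ _ (disjoint_compl_right)

theorem Gate.mul_star (g : Gate Q) :
    onQubits g.supp g.mat * (onQubits g.supp g.mat).conjTranspose = 1 := by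
  rw [onQubits_conjTranspose, onQubits_mul, mul_eq_one_comm.1 g.star_mul, onQubits_one]

theorem IsLocal.conj_gate {S : Finset Q} {A : Matrix (Q → Bit) (Q → Bit) ℂ} (hA : IsLocal S A)
    (g : Gate Q) :
    IsLocal (S ∪ g.supp)
      (onQubits g.supp g.mat * A * (onQubits g.supp g.mat).conjTranspose) := by
  intro T h hT
  rw [Finset.disjoint_union_left] at hT
  rw [onQubits_conjTranspose]
  exact ((onQubits_commute hT.2 _ _).mul_left (hA T h hT.1)).mul_left (onQubits_commute hT.2 _ _)

/-- A gate off the support commutes past `A` and cancels against its own adjoint; this is what keeps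
light cones small. -/
theorem IsLocal.conj_gate_of_disjoint {S : Finset Q} {A : Matrix (Q → Bit) (Q → Bit) ℂ}
    (hA : IsLocal S A) (g : Gate Q) (h : Disjoint S g.supp) :
    onQubits g.supp g.mat * A * (onQubits g.supp g.mat).conjTranspose = A := by
  rw [← (hA _ g.mat h).eq, mul_assoc, g.mul_star, mul_one]

open Classical in
/-- The qubits that interact with `q` in the layer `L`. -/
def Layer.nbhd (L : Layer Q) (q : Q) : Finset Q :=
  Finset.univ.filter fun p => p = q ∨ ∃ g ∈ L.gates, p ∈ g.supp ∧ q ∈ g.supp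

theorem Layer.mem_nbhd (L : Layer Q) (p q : Q) :
    p ∈ L.nbhd q ↔ p = q ∨ ∃ g ∈ L.gates, p ∈ g.supp ∧ q ∈ g.supp := by
  simp [Layer.nbhd]

theorem Layer.mem_nbhd_comm (L : Layer Q) (p q : Q) : p ∈ L.nbhd q ↔ q ∈ L.nbhd p := by
  simp only [mem_nbhd]
  constructor
  · rintro (h | ⟨g, hg, h1, h2⟩)
    exacts [Or.inl h.symm, Or.inr ⟨g, hg, h2, h1⟩]
  · rintro (h | ⟨g, hg, h1, h2⟩)
    exacts [Or.inl h.symm, Or.inr ⟨g, hg, h2, h1⟩]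

/-- The gates of a layer are disjoint, so `q` lies in at most one of them, and that gate has at most
two qubits. -/
theorem Layer.card_nbhd_le (L : Layer Q) (q : Q) : (L.nbhd q).card ≤ 2 := by
  by_cases h : ∃ g ∈ L.gates, q ∈ g.supp
  · obtain ⟨g, hg, hq⟩ := h
    refine (Finset.card_le_card ?_).trans g.card_le
    intro p hp
    rw [mem_nbhd] at hp
    obtain rfl | ⟨g', hg', hp', hq'⟩ := hp
    · exact hq
    · by_cases hgg : g = g'
      · rw [hgg]; exact hp'
      · have : Std.Symm fun g g' : Gate Q => Disjoint g.supp g'.supp := ⟨fun _ _ h => h.symm⟩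
        exact absurd hq' (Finset.disjoint_left.1 (L.disj.forall hg hg' hgg) hq)
  · have : L.nbhd q ⊆ {q} := by
      intro p hp
      rw [mem_nbhd] at hp
      obtain rfl | ⟨g', hg', hp', hq'⟩ := hp
      · simp
      · exact absurd ⟨g', hg', hq'⟩ h
    exact (Finset.card_le_card this).trans (by simp)

open Classical in
-- Only gates meeting the original `S` enlarge the support: gates of the same layer are disjoint
-- from each other, so the qubits added by one gate never meet another.
theorem IsLocal.conj_gates {S : Finset Q} {A : Matrix (Q → Bit) (Q → Bit) ℂ} (hA : IsLocal S A)
    (l : List (Gate Q)) (hl : l.Pairwise fun g g' => Disjoint g.supp g'.supp) :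
    IsLocal (S ∪ Finset.univ.filter fun p => ∃ g ∈ l, p ∈ g.supp ∧ ¬ Disjoint S g.supp)
      ((l.map fun g => onQubits g.supp g.mat).prod * A *
        (l.map fun g => onQubits g.supp g.mat).prod.conjTranspose) := by
  induction l with
  | nil =>
    simp only [List.map_nil, List.prod_nil, Matrix.conjTranspose_one, one_mul, mul_one]
    exact hA.mono Finset.subset_union_left
  | cons g l ih =>
    rw [List.pairwise_cons] at hl
    have ih := ih hl.2
    simp only [List.map_cons, List.prod_cons, Matrix.conjTranspose_mul]
    set M := (l.map fun g => onQubits g.supp g.mat).prod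
    have e : onQubits g.supp g.mat * M * A *
        (M.conjTranspose * (onQubits g.supp g.mat).conjTranspose) =
        onQubits g.supp g.mat * (M * A * M.conjTranspose) *
          (onQubits g.supp g.mat).conjTranspose := by
      simp only [mul_assoc]
    rw [e]
    by_cases hd : Disjoint S g.supp
    · rw [ih.conj_gate_of_disjoint]
      · refine ih.mono (Finset.union_subset_union_right ?_)
        intro p hp
        simp only [Finset.mem_filter, Finset.mem_univ, true_and, List.mem_cons] at hp ⊢
        obtain ⟨g', h1, h2⟩ := hp
        exact ⟨g', Or.inr h1, h2⟩
      · rw [Finset.disjoint_union_left]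
        refine ⟨hd, ?_⟩
        rw [Finset.disjoint_left]
        intro p hp
        simp only [Finset.mem_filter, Finset.mem_univ, true_and] at hp
        obtain ⟨g', h1, h2, _⟩ := hp
        exact Finset.disjoint_right.1 (hl.1 g' h1) h2
    · refine (ih.conj_gate g).mono ?_
      intro p hp
      simp only [Finset.mem_union, Finset.mem_filter, Finset.mem_univ, true_and,
        List.mem_cons] at hp ⊢
      obtain (h | ⟨g', h1, h2⟩) | h := hp
      · exact Or.inl h
      · exact Or.inr ⟨g', Or.inr h1, h2⟩
      · exact Or.inr ⟨g, Or.inl rfl, h, hd⟩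

theorem IsLocal.conj_layer {S : Finset Q} {A : Matrix (Q → Bit) (Q → Bit) ℂ} (hA : IsLocal S A)
    (L : Layer Q) :
    IsLocal (S.biUnion L.nbhd) (L.toMatrix * A * L.toMatrix.conjTranspose) := by
  classical
  refine (hA.conj_gates L.gates L.disj).mono ?_
  intro p hp
  simp only [Finset.mem_union, Finset.mem_filter, Finset.mem_univ, true_and] at hp
  rw [Finset.mem_biUnion]
  obtain h | ⟨g, h1, h2, h3⟩ := hp
  · exact ⟨p, h, (L.mem_nbhd _ _).2 (Or.inl rfl)⟩
  · obtain ⟨q, hq, hq'⟩ := Finset.not_disjoint_iff.1 h3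
    exact ⟨q, hq, (L.mem_nbhd _ _).2 (Or.inr ⟨g, h1, h2, hq'⟩)⟩

/-- The light cone of the input qubit `i`. -/
def cone : List (Layer Q) → Q → Finset Q
  | [], i => {i}
  | L :: U, i => (cone U i).biUnion L.nbhd

theorem card_cone_le (U : List (Layer Q)) (i : Q) : (cone U i).card ≤ 2 ^ U.length := by
  induction U with
  | nil => simp [cone]
  | cons L U ih =>
    rw [cone, List.length_cons, pow_succ]
    exact (Finset.card_biUnion_le_card_mul _ _ 2 fun q _ => L.card_nbhd_le q).trans
      (Nat.mul_le_mul_right 2 ih)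

/-- The dual of `card_cone_le`. Interaction within a layer is symmetric, so tracing back from an
output qubit also at most doubles the set at each layer. -/
theorem card_mem_cone_le (U : List (Layer Q)) (q : Q) :
    (Finset.univ.filter fun i => q ∈ cone U i).card ≤ 2 ^ U.length := by
  induction U generalizing q with
  | nil => simp [cone, Finset.filter_eq]
  | cons L U ih =>
    have : (Finset.univ.filter fun i => q ∈ cone (L :: U) i) ⊆
        (L.nbhd q).biUnion fun p => Finset.univ.filter fun i => p ∈ cone U i := by
      intro i hi
      simp only [cone, Finset.mem_filter, Finset.mem_univ, true_and, Finset.mem_biUnion] at hi ⊢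
      obtain ⟨p, hp, hq⟩ := hi
      exact ⟨p, (L.mem_nbhd_comm _ _).1 hq, hp⟩
    refine (Finset.card_le_card this).trans ?_
    rw [List.length_cons, pow_succ, mul_comm]
    exact (Finset.card_biUnion_le_card_mul _ _ (2 ^ U.length) fun p _ => ih p).trans
      (Nat.mul_le_mul_right _ (L.card_nbhd_le q))

theorem IsLocal.conj_circuit {i : Q} {A : Matrix (Q → Bit) (Q → Bit) ℂ} (hA : IsLocal {i} A)
    (U : Circuit Q) :
    IsLocal (cone U i)
      (Circuit.toMatrix U * A * (Circuit.toMatrix U).conjTranspose) := by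
  induction U with
  | nil => simpa [cone, Circuit.toMatrix] using hA
  | cons L U ih =>
    have e : Circuit.toMatrix (L :: U) = L.toMatrix * Circuit.toMatrix U := by
      simp [Circuit.toMatrix]
    rw [e, cone, Matrix.conjTranspose_mul]
    have := IsLocal.conj_layer ih L
    simpa only [mul_assoc] using this

theorem prod_mul_conjTranspose_eq_one {ι : Type} [Fintype ι] [DecidableEq ι]
    (l : List (Matrix ι ι ℂ)) (hl : ∀ A ∈ l, A * A.conjTranspose = 1) :
    l.prod * l.prod.conjTranspose = 1 := by
  induction l with
  | nil => simp
  | cons A l ih =>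
    rw [List.prod_cons, Matrix.conjTranspose_mul, mul_assoc, ← mul_assoc l.prod,
      ih fun B hB => hl B (List.mem_cons_of_mem _ hB), one_mul, hl A List.mem_cons_self]

theorem Layer.mul_star (L : Layer Q) : L.toMatrix * L.toMatrix.conjTranspose = 1 := by
  apply prod_mul_conjTranspose_eq_one
  intro A hA
  obtain ⟨g, _, rfl⟩ := List.mem_map.1 hA
  exact g.mul_star

theorem Circuit.mul_star (U : Circuit Q) :
    Circuit.toMatrix U * (Circuit.toMatrix U).conjTranspose = 1 := by
  apply prod_mul_conjTranspose_eq_one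
  intro A hA
  obtain ⟨g, _, rfl⟩ := List.mem_map.1 hA
  exact g.mul_star

end Locality

/-! ### A Poincaré inequality for the outputs of shallow circuits -/

section Poincare

/-- The squared norm of a vector. -/
noncomputable def normSq {ι : Type} [Fintype ι] (v : ι → ℂ) : ℝ := ∑ x, ‖v x‖ ^ 2

theorem star_dotProduct_self {ι : Type} [Fintype ι] (v : ι → ℂ) :
    star v ⬝ᵥ v = (normSq v : ℂ) := by
  simp only [dotProduct, normSq, Pi.star_apply, RCLike.star_def, Complex.ofReal_sum,
    Complex.conj_mul', Complex.ofReal_pow]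

theorem normSq_mulVec_of_star_mul {ι : Type} [Fintype ι] [DecidableEq ι] (A : Matrix ι ι ℂ)
    (hA : A.conjTranspose * A = 1) (v : ι → ℂ) : normSq (A.mulVec v) = normSq v := by
  have h : (normSq (A.mulVec v) : ℂ) = normSq v := by
    rw [← star_dotProduct_self, ← star_dotProduct_self, Matrix.star_mulVec,
      Matrix.dotProduct_mulVec, Matrix.vecMul_vecMul, hA, Matrix.vecMul_one]
  exact_mod_cast h

theorem normSq_diagonal_mulVec_le {ι : Type} [Fintype ι] [DecidableEq ι] (D v : ι → ℂ) (c : ℝ)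
    (hD : ∀ x, ‖D x‖ ≤ c) : normSq ((Matrix.diagonal D).mulVec v) ≤ c ^ 2 * normSq v := by
  rw [normSq, normSq, Finset.mul_sum]
  refine Finset.sum_le_sum fun x _ => ?_
  rw [Matrix.mulVec_diagonal, norm_mul, mul_pow]
  gcongr
  exact hD x

variable {Q : Type} [Fintype Q] [DecidableEq Q]

/-- The projector `|1⟩⟨1|` on the qubit `i`. -/
noncomputable def numberOp (i : Q) : Matrix (Q → Bit) (Q → Bit) ℂ :=
  Matrix.diagonal fun x => if x i = 0 then 0 else 1

theorem isLocal_numberOp (i : Q) : IsLocal {i} (numberOp i) := by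
  intro T h hT
  ext x y
  simp only [numberOp, Matrix.diagonal_mul, Matrix.mul_diagonal, onQubits]
  by_cases h : ∀ q, q ∉ T → x q = y q
  · have := h i (by simpa using hT)
    simp only [this, mul_comm]
  · simp only [if_neg h, zero_mul, mul_zero]

theorem normSq_numberOp_mulVec_le (i : Q) (v : (Q → Bit) → ℂ) :
    normSq ((numberOp i).mulVec v) ≤ normSq v := by
  have := normSq_diagonal_mulVec_le (fun x : Q → Bit => if x i = 0 then (0 : ℂ) else 1) v 1
    (fun x => by split_ifs <;> simp)
  simpa [numberOp] using this

/-- The total number operator has a spectral gap above the all-zero state. -/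
theorem normSq_sub_le_sum_numberOp (v : (Q → Bit) → ℂ) :
    normSq v - ‖v 0‖ ^ 2 ≤ ∑ i, normSq ((numberOp i).mulVec v) := by
  have e : normSq v - ‖v 0‖ ^ 2 = ∑ x : Q → Bit, if x = 0 then 0 else ‖v x‖ ^ 2 := by
    rw [normSq, ← Finset.add_sum_erase _ _ (Finset.mem_univ (0 : Q → Bit)),
      ← Finset.add_sum_erase Finset.univ (fun x : Q → Bit => if x = 0 then 0 else ‖v x‖ ^ 2)
        (Finset.mem_univ (0 : Q → Bit)), if_pos rfl, zero_add, add_sub_cancel_left]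
    exact Finset.sum_congr rfl fun x hx => by rw [if_neg (Finset.ne_of_mem_erase hx)]
  rw [e]
  simp only [normSq]
  rw [Finset.sum_comm]
  refine Finset.sum_le_sum fun x _ => ?_
  split_ifs with hx
  · exact Finset.sum_nonneg fun _ _ => by positivity
  · obtain ⟨i, hi⟩ := Function.ne_iff.1 hx
    have : ‖v x‖ ^ 2 = ‖(numberOp i).mulVec v x‖ ^ 2 := by
      rw [numberOp, Matrix.mulVec_diagonal, if_neg (by simpa using hi), one_mul]
    rw [this]
    exact Finset.single_le_sum (f := fun i => ‖(numberOp i).mulVec v x‖ ^ 2)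
      (fun _ _ => by positivity) (Finset.mem_univ i)

/-- The distribution of the measurement outcome of the output of a circuit of depth `t` satisfies
a Poincaré inequality with constant `8 ^ t`. -/
theorem variance_circuit_output_le (U : Circuit Q) (M : Finset Q) (f : (Q → Bit) → ℝ)
    (hf : ∀ x y : Q → Bit, |f x - f y| ≤ (M.filter fun q => x q ≠ y q).card) :
    ∑ x, f x ^ 2 * ‖Circuit.output U x‖ ^ 2 - (∑ x, f x * ‖Circuit.output U x‖ ^ 2) ^ 2 ≤
      M.card * 8 ^ Circuit.depth U := by
  set W := Circuit.toMatrix U with hW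
  have hWs : W * W.conjTranspose = 1 := Circuit.mul_star U
  have hWs' : W.conjTranspose * W = 1 := mul_eq_one_comm.1 hWs
  set ψ := Circuit.output U with hψ
  have hψW : ψ = W.mulVec zeroState := rfl
  have hψ1 : normSq ψ = 1 := by
    rw [hψW, normSq_mulVec_of_star_mul W hWs', normSq, Finset.sum_eq_single 0]
    · simp [zeroState]
    · intro x _ hx; simp [zeroState, hx]
    · simp
  -- Undoing the circuit turns the second moment of `f` into the squared norm of `v` and the mean
  -- into its amplitude at 0, so the variance is the weight of `v` off the all-zero state.
  set v := W.conjTranspose.mulVec ((Matrix.diagonal fun x => (f x : ℂ)).mulVec ψ) with hv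
  have h1 : normSq v = ∑ x, f x ^ 2 * ‖ψ x‖ ^ 2 := by
    rw [hv, normSq_mulVec_of_star_mul _ (by rwa [Matrix.conjTranspose_conjTranspose]), normSq]
    refine Finset.sum_congr rfl fun x _ => ?_
    rw [Matrix.mulVec_diagonal, norm_mul, mul_pow, Complex.norm_real, Real.norm_eq_abs, sq_abs]
  have h2 : v 0 = ((∑ x, f x * ‖ψ x‖ ^ 2 : ℝ) : ℂ) := by
    have hψx : ∀ x, ψ x = W x 0 := fun x => by
      rw [hψW, zeroState, Matrix.mulVec_single_one]; rfl
    rw [hv, Matrix.mulVec, dotProduct]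
    push_cast
    refine Finset.sum_congr rfl fun x _ => ?_
    rw [Matrix.mulVec_diagonal, Matrix.conjTranspose_apply, ← hψx, RCLike.star_def,
      ← Complex.conj_mul']
    ring
  have h3 : ‖v 0‖ ^ 2 = (∑ x, f x * ‖ψ x‖ ^ 2) ^ 2 := by
    rw [h2, Complex.norm_real, Real.norm_eq_abs, sq_abs]
  rw [← h1, ← h3]
  refine (normSq_sub_le_sum_numberOp v).trans ?_
  have key : ∀ i, normSq ((numberOp i).mulVec v) ≤
      if (cone U i ∩ M).Nonempty then 4 ^ Circuit.depth U else 0 := by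
    intro i
    set A := W * numberOp i * W.conjTranspose with hA
    have hAloc : IsLocal (cone U i) A := (isLocal_numberOp i).conj_circuit U
    -- The evolved number operator kills the output state, because the number operator kills the
    -- all-zero input.
    have hAψ : A.mulVec ψ = 0 := by
      rw [hA, hψW, Matrix.mulVec_mulVec, mul_assoc, hWs', mul_one, ← Matrix.mulVec_mulVec]
      have : (numberOp i).mulVec zeroState = 0 := by
        funext x
        rw [numberOp, Matrix.mulVec_diagonal, zeroState]
        by_cases hx : x = 0
        · subst hx; simp
        · simp [hx]
      rw [this, Matrix.mulVec_zero]
    have hn : normSq ((numberOp i).mulVec v) =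
        normSq (A.mulVec ((Matrix.diagonal fun x => (f x : ℂ)).mulVec ψ)) := by
      rw [← normSq_mulVec_of_star_mul W hWs', hv, hA]
      simp only [Matrix.mulVec_mulVec, mul_assoc]
    -- `g` forgets the bits in the light cone, so it commutes with `A`, and `A` annihilates g ψ.
    -- Hence `f` may be replaced by f - g, which is at most the number of qubits of `M` in the cone.
    set g : (Q → Bit) → ℝ := fun x => f fun q => if q ∈ cone U i then 0 else x q with hg
    have hgc : A.mulVec ((Matrix.diagonal fun x => (g x : ℂ)).mulVec ψ) = 0 := by
      have := (hAloc.commute_diagonal (fun x => (g x : ℂ)) (by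
        intro x y hxy
        have : (fun q => if q ∈ cone U i then 0 else x q) =
            fun q => if q ∈ cone U i then 0 else y q := by
          funext q
          split_ifs with h
          · rfl
          · exact hxy q h
        simp only [hg, this])).eq
      rw [Matrix.mulVec_mulVec, this, ← Matrix.mulVec_mulVec, hAψ, Matrix.mulVec_zero]
    have hfg : A.mulVec ((Matrix.diagonal fun x => (f x : ℂ)).mulVec ψ) =
        A.mulVec ((Matrix.diagonal fun x => ((f x - g x : ℝ) : ℂ)).mulVec ψ) := by
      rw [← sub_zero (A.mulVec ((Matrix.diagonal fun x => (f x : ℂ)).mulVec ψ)), ← hgc,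
        ← Matrix.mulVec_sub, ← Matrix.sub_mulVec, Matrix.diagonal_sub]
      simp only [Complex.ofReal_sub]
    have hdiff : ∀ x, |f x - g x| ≤ ((cone U i ∩ M).card : ℝ) := by
      intro x
      refine (hf _ _).trans ?_
      exact_mod_cast Finset.card_le_card fun q hq => by
        rw [Finset.mem_filter] at hq
        rw [Finset.mem_inter]
        refine ⟨?_, hq.1⟩
        by_contra hc
        simp [hc] at hq
    have hle : normSq ((numberOp i).mulVec v) ≤ ((cone U i ∩ M).card : ℝ) ^ 2 := by
      have hA1 : ∀ w, normSq (A.mulVec w) ≤ normSq w := by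
        intro w
        rw [hA, ← Matrix.mulVec_mulVec, ← Matrix.mulVec_mulVec, normSq_mulVec_of_star_mul W hWs']
        refine (normSq_numberOp_mulVec_le i _).trans (le_of_eq ?_)
        exact normSq_mulVec_of_star_mul _ (by rwa [Matrix.conjTranspose_conjTranspose]) _
      rw [hn, hfg]
      refine (hA1 _).trans ((normSq_diagonal_mulVec_le _ _ ((cone U i ∩ M).card : ℝ) (fun x => ?_)).trans (le_of_eq ?_))
      · rw [Complex.norm_real]; exact hdiff x
      · rw [hψ1, mul_one]
    refine hle.trans ?_
    split_ifs with hne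
    · have : ((cone U i ∩ M).card : ℝ) ≤ 2 ^ Circuit.depth U := by
        exact_mod_cast (Finset.card_le_card Finset.inter_subset_left).trans (card_cone_le U i)
      calc ((cone U i ∩ M).card : ℝ) ^ 2 ≤ (2 ^ Circuit.depth U) ^ 2 := by gcongr
        _ = 4 ^ Circuit.depth U := by rw [← pow_mul, mul_comm, pow_mul]; norm_num
    · rw [Finset.not_nonempty_iff_eq_empty] at hne
      simp [hne]
  refine (Finset.sum_le_sum fun i _ => key i).trans ?_
  rw [← Finset.sum_filter, Finset.sum_const, nsmul_eq_mul]
  have hc : (Finset.univ.filter fun i => (cone U i ∩ M).Nonempty).card ≤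
      M.card * 2 ^ Circuit.depth U := by
    refine (Finset.card_le_card (t := M.biUnion fun q =>
      Finset.univ.filter fun i => q ∈ cone U i) ?_).trans
      (Finset.card_biUnion_le_card_mul _ _ _ fun q _ => card_mem_cone_le U q)
    intro i hi
    obtain ⟨q, hq⟩ := (Finset.mem_filter.1 hi).2
    rw [Finset.mem_inter] at hq
    exact Finset.mem_biUnion.2 ⟨q, hq.2, Finset.mem_filter.2 ⟨Finset.mem_univ _, hq.1⟩⟩
  have hc' : ((Finset.univ.filter fun i => (cone U i ∩ M).Nonempty).card : ℝ) ≤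
      M.card * 2 ^ Circuit.depth U := by exact_mod_cast hc
  calc _ ≤ (M.card * 2 ^ Circuit.depth U : ℝ) * 4 ^ Circuit.depth U := by gcongr
    _ = M.card * 8 ^ Circuit.depth U := by rw [mul_assoc, ← mul_pow]; norm_num

theorem normSq_circuit_output (U : Circuit Q) : normSq (Circuit.output U) = 1 := by
  have hW : (Circuit.toMatrix U).conjTranspose * Circuit.toMatrix U = 1 :=
    mul_eq_one_comm.1 (Circuit.mul_star U)
  rw [Circuit.output, normSq_mulVec_of_star_mul _ hW, normSq, Finset.sum_eq_single 0]
  · simp [zeroState]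
  · intro x _ hx; simp [zeroState, hx]
  · simp

end Poincare

/-! ### Trace distance and measurement statistics -/

section TraceNorm

variable {ι : Type} [Fintype ι] [DecidableEq ι]

/-- Duality between trace norm and operator norm: the trace of DA is computed in an orthonormal
eigenbasis of A*A, on which A has the singular values as norms, while D is a contraction. -/
theorem abs_sum_diag_le_traceNorm (A : Matrix ι ι ℂ) (D : ι → ℝ) (hD : ∀ x, |D x| ≤ 1) :
    ‖∑ x, (D x : ℂ) * A x x‖ ≤ traceNorm A := by
  set T := Matrix.toEuclideanLin A with hT
  have hn : Module.finrank ℂ (EuclideanSpace ℂ ι) = Fintype.card ι := finrank_euclideanSpace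
  set b := T.isSymmetric_adjoint_comp_self.eigenvectorBasis hn with hb
  set S := Matrix.toEuclideanLin (Matrix.diagonal fun x => (D x : ℂ)) with hS
  have hTb : ∀ i, ‖T (b i)‖ = T.singularValues i := by
    intro i
    have h1 : ‖T (b i)‖ ^ 2 = (T.singularValues i) ^ 2 := by
      rw [T.sq_singularValues_fin hn]
      have h2 := T.isSymmetric_adjoint_comp_self.apply_eigenvectorBasis hn i
      have h3 : inner ℂ (T (b i)) (T (b i)) =
          ((T.isSymmetric_adjoint_comp_self.eigenvalues hn i : ℝ) : ℂ) := by
        rw [← LinearMap.adjoint_inner_right, ← LinearMap.comp_apply, h2,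
          inner_smul_right, inner_self_eq_norm_sq_to_K, OrthonormalBasis.norm_eq_one]
        simp
      rw [inner_self_eq_norm_sq_to_K] at h3
      have h4 : (((‖T (b i)‖ ^ 2 : ℝ)) : ℂ) =
          ((T.isSymmetric_adjoint_comp_self.eigenvalues hn i : ℝ) : ℂ) := by
        rw [← h3]; push_cast; rfl
      exact Complex.ofReal_injective h4
    rwa [sq_eq_sq₀ (norm_nonneg _) (T.singularValues_nonneg _)] at h1
  have hSn : ∀ w, ‖S w‖ ≤ ‖w‖ := by
    intro w
    rw [EuclideanSpace.norm_eq, EuclideanSpace.norm_eq]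
    apply Real.sqrt_le_sqrt
    refine Finset.sum_le_sum fun x _ => ?_
    have : (S w) x = (D x : ℂ) * w x := by
      rw [hS, Matrix.toLpLin_apply]
      exact Matrix.mulVec_diagonal _ _ _
    rw [this, norm_mul, Complex.norm_real, Real.norm_eq_abs]
    have := mul_le_of_le_one_left (norm_nonneg (w x)) (hD x)
    gcongr
  have htr : ∑ x, (D x : ℂ) * A x x = LinearMap.trace ℂ _ (S ∘ₗ T) := by
    have e : S ∘ₗ T = Matrix.toEuclideanLin (Matrix.diagonal (fun x => (D x : ℂ)) * A) := by
      rw [hS, hT]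
      ext w
      simp [Matrix.toLpLin_apply, Matrix.mulVec_mulVec]
    rw [e, Matrix.toEuclideanLin_eq_toLin_orthonormal, Matrix.trace_toLin_eq]
    simp [Matrix.trace, Matrix.diagonal_mul]
  rw [htr, LinearMap.trace_eq_sum_inner _ b]
  refine (norm_sum_le _ _).trans ?_
  rw [traceNorm, Finset.sum_range]
  refine Finset.sum_le_sum fun i _ => ?_
  refine (norm_inner_le_norm _ _).trans ?_
  rw [OrthonormalBasis.norm_eq_one, one_mul, LinearMap.comp_apply]
  exact (hSn _).trans (hTb i).le

/-- The statistics of a measurement in the computational basis are close for states that are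
close in trace distance. -/
theorem abs_sum_sub_sum_le_traceDist (φ ψ : ι → ℂ) (h1 : normSq φ = normSq ψ) (S : Finset ι) :
    |∑ x ∈ S, ‖φ x‖ ^ 2 - ∑ x ∈ S, ‖ψ x‖ ^ 2| ≤ traceDist φ ψ := by
  -- Signs instead of an indicator: with equal total masses they double the difference of the
  -- probabilities, which absorbs the factor 1/2 of the trace distance.
  have h := abs_sum_diag_le_traceNorm (ketbra φ - ketbra ψ) (fun x => if x ∈ S then 1 else -1)
    (fun x => by split_ifs <;> simp)
  have hk : ∀ (χ : ι → ℂ) x, ketbra χ x x = ((‖χ x‖ ^ 2 : ℝ) : ℂ) := by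
    intro χ x
    simp [ketbra, Matrix.vecMulVec_apply, Complex.mul_conj']
  have e : ∑ x, (((if x ∈ S then 1 else -1 : ℝ) : ℝ) : ℂ) * (ketbra φ - ketbra ψ) x x =
      ((2 * (∑ x ∈ S, ‖φ x‖ ^ 2 - ∑ x ∈ S, ‖ψ x‖ ^ 2) : ℝ) : ℂ) := by
    have : ∀ χ : ι → ℂ, ∑ x, (if x ∈ S then 1 else -1 : ℝ) * ‖χ x‖ ^ 2 =
        2 * ∑ x ∈ S, ‖χ x‖ ^ 2 - normSq χ := by
      intro χ
      rw [normSq, ← Finset.sum_filter_add_sum_filter_not Finset.univ (· ∈ S) fun x => ‖χ x‖ ^ 2,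
        ← Finset.sum_filter_add_sum_filter_not Finset.univ (· ∈ S)]
      rw [Finset.sum_congr rfl (g := fun x => ‖χ x‖ ^ 2)
        (fun x hx => by rw [if_pos (Finset.mem_filter.1 hx).2, one_mul]),
        Finset.sum_congr (s₁ := Finset.univ.filter (· ∉ S)) rfl (g := fun x => -‖χ x‖ ^ 2)
        (fun x hx => by rw [if_neg (Finset.mem_filter.1 hx).2]; ring), Finset.sum_neg_distrib]
      have : Finset.univ.filter (· ∈ S) = S := by ext; simp
      rw [this]
      ring
    have e2 : 2 * (∑ x ∈ S, ‖φ x‖ ^ 2 - ∑ x ∈ S, ‖ψ x‖ ^ 2) =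
        ∑ x, ((if x ∈ S then 1 else -1 : ℝ) * ‖φ x‖ ^ 2 -
          (if x ∈ S then 1 else -1 : ℝ) * ‖ψ x‖ ^ 2) := by
      rw [Finset.sum_sub_distrib, this, this, h1]
      ring
    rw [e2, Complex.ofReal_sum]
    refine Finset.sum_congr rfl fun x _ => ?_
    rw [Matrix.sub_apply, hk, hk]
    push_cast
    ring
  rw [e, Complex.norm_real, Real.norm_eq_abs, abs_mul, abs_two] at h
  rw [traceDist]
  linarith

end TraceNorm

/-! ### The expander mixing lemma -/

section Expander

theorem inner_mulVec_eq_sum_eigenvalues {V : Type} [Fintype V] [DecidableEq V]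
    {A : Matrix V V ℝ} (hA : A.IsHermitian) (x : EuclideanSpace ℝ V) :
    inner ℝ x (Matrix.toEuclideanLin A x) =
      ∑ i, hA.eigenvalues i * inner ℝ (hA.eigenvectorBasis i) x ^ 2 := by
  have hs : ∀ i, inner ℝ (hA.eigenvectorBasis i) (Matrix.toEuclideanLin A x) =
      hA.eigenvalues i * inner ℝ (hA.eigenvectorBasis i) x := by
    intro i
    rw [← (Matrix.isSymmetric_toEuclideanLin_iff.mpr hA), Matrix.toLpLin_apply,
      hA.mulVec_eigenvectorBasis i, WithLp.toLp_smul, inner_smul_left]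
    rfl
  rw [← hA.eigenvectorBasis.sum_inner_mul_inner]
  refine Finset.sum_congr rfl fun i _ => ?_
  rw [hs, real_inner_comm]
  ring

variable {V : Type} [Fintype V] [DecidableEq V] (G : SimpleGraph V) [DecidableRel G.Adj]

theorem secondEigenvalue_nonneg : 0 ≤ secondEigenvalue G := by
  rw [secondEigenvalue]
  split_ifs
  · exact (abs_nonneg _).trans (le_max_left _ _)
  · exact le_rfl

/-- In decreasing order every eigenvalue except the first lies between λ₂ and λₙ. The exceptional
`i₀` is an index and not a value, so multiplicities do no harm. -/
theorem exists_abs_eigenvalues_le_secondEigenvalue (hV : 2 ≤ Fintype.card V) :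
    ∃ i₀, ∀ i ≠ i₀, |(G.isHermitian_adjMatrix ℝ).eigenvalues i| ≤ secondEigenvalue G := by
  set hA := G.isHermitian_adjMatrix ℝ
  set e := (Fintype.equivOfCardEq (Fintype.card_fin (Fintype.card V)) :
    Fin (Fintype.card V) ≃ V)
  refine ⟨e ⟨0, by omega⟩, fun i hi => ?_⟩
  have h0 : e.symm i ≠ ⟨0, by omega⟩ := fun h => hi (by rw [← h, e.apply_symm_apply])
  have hle : (⟨1, by omega⟩ : Fin (Fintype.card V)) ≤ e.symm i := by
    rw [Fin.le_def]
    have : (e.symm i).val ≠ 0 := fun h => h0 (Fin.ext h)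
    show 1 ≤ (e.symm i).val
    omega
  have hge : e.symm i ≤ (⟨Fintype.card V - 1, by omega⟩ : Fin (Fintype.card V)) := by
    rw [Fin.le_def]
    have := (e.symm i).2
    show (e.symm i).val ≤ Fintype.card V - 1
    omega
  have h1 := hA.eigenvalues₀_antitone hle
  have h2 := hA.eigenvalues₀_antitone hge
  rw [secondEigenvalue, dif_pos hV]
  show |hA.eigenvalues₀ (e.symm i)| ≤ _
  exact (abs_le_max_abs_abs h2 h1).trans (max_comm _ _).le

/-- The expander mixing lemma, for the edges inside a set `T` of vertices. -/
theorem card_adj_le_of_regular {d : ℕ} (hG : G.IsRegularOfDegree d) (hV : 2 ≤ Fintype.card V)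
    (T : Finset V) :
    ((∑ v ∈ T, (T.filter fun w => G.Adj v w).card : ℕ) : ℝ) ≤
      d * (T.card : ℝ) ^ 2 / Fintype.card V + secondEigenvalue G * T.card := by
  set l := secondEigenvalue G with hl
  -- If d ≤ λ, the trivial degree bound suffices. Otherwise d exceeds every eigenvalue other than
  -- the one at `i₀`, which spares any discussion of connectivity.
  by_cases hld : (d : ℝ) ≤ l
  · have h1 : ((∑ v ∈ T, (T.filter fun w => G.Adj v w).card : ℕ) : ℝ) ≤ l * T.card := by
      push_cast
      rw [mul_comm, ← nsmul_eq_mul]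
      refine Finset.sum_le_card_nsmul _ _ _ fun v _ => le_trans ?_ hld
      rw [← hG v, ← G.card_neighborFinset_eq_degree]
      exact_mod_cast Finset.card_le_card fun w hw => by
        rw [SimpleGraph.mem_neighborFinset]; exact (Finset.mem_filter.1 hw).2
    have : 0 ≤ d * (T.card : ℝ) ^ 2 / Fintype.card V := by positivity
    linarith
  push Not at hld
  set hA := G.isHermitian_adjMatrix ℝ
  obtain ⟨i₀, hi₀⟩ := exists_abs_eigenvalues_le_secondEigenvalue G hV
  set u := hA.eigenvectorBasis
  set x : EuclideanSpace ℝ V := WithLp.toLp 2 (fun v => if v ∈ T then 1 else 0) with hx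
  set e : EuclideanSpace ℝ V := WithLp.toLp 2 (fun _ => 1) with he
  have hAe : Matrix.toEuclideanLin (G.adjMatrix ℝ) e = (d : ℝ) • e := by
    rw [Matrix.toLpLin_apply, he, ← WithLp.toLp_smul]
    congr 1
    funext v
    have := G.adjMatrix_mulVec_const_apply_of_regular (α := ℝ) (a := 1) hG (v := v)
    simpa [Function.const_def] using this
  have hue : ∀ i, hA.eigenvalues i * inner ℝ (u i) e = d * inner ℝ (u i) e := by
    intro i
    have h1 : inner ℝ (u i) (Matrix.toEuclideanLin (G.adjMatrix ℝ) e) =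
        hA.eigenvalues i * inner ℝ (u i) e := by
      rw [← (Matrix.isSymmetric_toEuclideanLin_iff.mpr hA), Matrix.toLpLin_apply,
        hA.mulVec_eigenvectorBasis i, WithLp.toLp_smul, inner_smul_left]
      rfl
    rw [← h1, hAe, inner_smul_right]
  -- The all-ones vector has eigenvalue d, so it is orthogonal to every eigenvector with eigenvalue
  -- at most λ < d and is thus a multiple of the one at `i₀`.
  have hz : ∀ i ≠ i₀, inner ℝ (u i) e = 0 := by
    intro i hi
    by_contra hc
    have := mul_right_cancel₀ hc (hue i)
    have h2 := (le_abs_self _).trans (hi₀ i hi)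
    rw [this] at h2
    linarith
  set c := inner ℝ (u i₀) e with hc
  have hee : c ^ 2 = Fintype.card V := by
    have h1 := u.sum_inner_mul_inner e e
    rw [Finset.sum_eq_single i₀ (fun i _ hi => by rw [hz i hi, mul_zero]) (by simp),
      real_inner_comm, ← hc] at h1
    have h2 : inner ℝ e e = (Fintype.card V : ℝ) := by
      rw [PiLp.inner_apply]; simp [he]
    rw [← h2, ← h1, sq]
  have hVpos : (0 : ℝ) < Fintype.card V := by
    have : 0 < Fintype.card V := by omega
    exact_mod_cast this
  have hc0 : c ≠ 0 := by
    intro h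
    rw [h] at hee
    norm_num at hee
    linarith
  have hd : hA.eigenvalues i₀ = d := mul_right_cancel₀ hc0 (hue i₀)
  have hxe : c * inner ℝ (u i₀) x = T.card := by
    have h1 := u.sum_inner_mul_inner e x
    rw [Finset.sum_eq_single i₀ (fun i _ hi => by
      rw [real_inner_comm, hz i hi, zero_mul]) (by simp), real_inner_comm, ← hc] at h1
    rw [h1]
    simp [he, hx, PiLp.inner_apply]
  have hxx : ∑ i, inner ℝ (u i) x ^ 2 = T.card := by
    have h1 := u.sum_inner_mul_inner x x
    have h2 : inner ℝ x x = (T.card : ℝ) := by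
      rw [PiLp.inner_apply]; simp [hx]
    rw [← h2, ← h1]
    refine Finset.sum_congr rfl fun i _ => ?_
    rw [real_inner_comm x (u i), sq]
  have hq := inner_mulVec_eq_sum_eigenvalues hA x
  have hcount : inner ℝ x (Matrix.toEuclideanLin (G.adjMatrix ℝ) x) =
      ((∑ v ∈ T, (T.filter fun w => G.Adj v w).card : ℕ) : ℝ) := by
    rw [PiLp.inner_apply]
    simp only [Matrix.toLpLin_apply, hx, SimpleGraph.adjMatrix_mulVec_apply]
    push_cast
    rw [← Finset.sum_filter_add_sum_filter_not Finset.univ (· ∈ T)]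
    have e0 : ∑ v with v ∉ T, inner ℝ (if v ∈ T then (1 : ℝ) else 0)
        (∑ w ∈ G.neighborFinset v, if w ∈ T then (1 : ℝ) else 0) = 0 :=
      Finset.sum_eq_zero fun v hv => by simp [(Finset.mem_filter.1 hv).2]
    rw [e0, add_zero]
    have : Finset.univ.filter (· ∈ T) = T := by ext; simp
    rw [this]
    refine Finset.sum_congr rfl fun v hv => ?_
    rw [if_pos hv]
    simp only [Finset.sum_ite, Finset.sum_const_zero, add_zero, Finset.sum_const, nsmul_eq_mul,
      mul_one, RCLike.inner_apply, map_one]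
    norm_cast
    congr 1
    ext w
    simp [and_comm]
  rw [← hcount, hq, ← Finset.add_sum_erase _ _ (Finset.mem_univ i₀), hd]
  have hT : inner ℝ (u i₀) x ^ 2 = (T.card : ℝ) ^ 2 / Fintype.card V := by
    rw [← hxe, ← hee]
    field_simp
  rw [hT, mul_div_assoc]
  gcongr
  calc ∑ i ∈ Finset.univ.erase i₀, hA.eigenvalues i * inner ℝ (u i) x ^ 2
      ≤ ∑ i ∈ Finset.univ.erase i₀, l * inner ℝ (u i) x ^ 2 := by
        refine Finset.sum_le_sum fun i hi => ?_
        gcongr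
        exact (le_abs_self _).trans (hi₀ i (Finset.ne_of_mem_erase hi))
    _ = l * ∑ i ∈ Finset.univ.erase i₀, inner ℝ (u i) x ^ 2 := by rw [Finset.mul_sum]
    _ ≤ l * ∑ i, inner ℝ (u i) x ^ 2 := by
        gcongr
        · exact secondEigenvalue_nonneg G
        · exact Finset.subset_univ _
    _ = l * T.card := by rw [hxx]

end Expander

/-! ### Ground spaces of sums of projectors -/

section GroundSpace

open scoped ComplexOrder

variable {ι : Type} [Fintype ι] [DecidableEq ι]

theorem toEuclideanLin_imageProj (A : Matrix ι ι ℂ) :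
    Matrix.toEuclideanLin (imageProj A) =
      (LinearMap.range (Matrix.toEuclideanLin A)).starProjection.toLinearMap :=
  LinearEquiv.apply_symm_apply _ _

theorem imageProj_isHermitian (A : Matrix ι ι ℂ) : (imageProj A).IsHermitian := by
  rw [← Matrix.isSymmetric_toEuclideanLin_iff, toEuclideanLin_imageProj]
  exact Submodule.starProjection_isSymmetric _

theorem imageProj_mul_self (A : Matrix ι ι ℂ) : imageProj A * imageProj A = imageProj A := by
  apply Matrix.toEuclideanLin.injective
  have e : Matrix.toEuclideanLin (imageProj A * imageProj A) =
      Matrix.toEuclideanLin (imageProj A) ∘ₗ Matrix.toEuclideanLin (imageProj A) := by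
    ext w
    simp [Matrix.toLpLin_apply, Matrix.mulVec_mulVec]
  rw [e, toEuclideanLin_imageProj]
  ext1 w
  exact congrArg (fun f => f w)
    (Submodule.isIdempotentElem_starProjection (LinearMap.range (Matrix.toEuclideanLin A))).eq

theorem imageProj_posSemidef (A : Matrix ι ι ℂ) : (imageProj A).PosSemidef := by
  have := Matrix.posSemidef_conjTranspose_mul_self (imageProj A)
  rwa [(imageProj_isHermitian A).eq, imageProj_mul_self] at this

/-- The projector onto the range vanishes on the orthogonal complement of the range, which is the
kernel for a Hermitian matrix. -/
theorem imageProj_mulVec_eq_zero_iff {A : Matrix ι ι ℂ} (hA : A.IsHermitian) (x : ι → ℂ) :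
    (imageProj A).mulVec x = 0 ↔ A.mulVec x = 0 := by
  have h1 : (imageProj A).mulVec x = 0 ↔
      Matrix.toEuclideanLin (imageProj A) (WithLp.toLp 2 x) = 0 := by
    rw [Matrix.toLpLin_apply, WithLp.toLp_eq_zero]
  have h2 : A.mulVec x = 0 ↔ Matrix.toEuclideanLin A (WithLp.toLp 2 x) = 0 := by
    rw [Matrix.toLpLin_apply, WithLp.toLp_eq_zero]
  rw [h1, h2, toEuclideanLin_imageProj]
  refine (Submodule.starProjection_apply_eq_zero_iff _).trans ?_
  rw [(Matrix.isSymmetric_toEuclideanLin_iff.mpr hA).orthogonal_range, LinearMap.mem_ker]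

variable {κ : Type}

theorem groundEnergy_eq_zero {H : Matrix ι ι ℂ} (hH : H.PosSemidef) {ψ : ι → ℂ} (hψ : ψ ≠ 0)
    (h : H.mulVec ψ = 0) : groundEnergy H = 0 := by
  have h0 : (0 : ℝ) ∈ spectrum ℝ H := by
    rw [spectrum.zero_mem_iff]
    intro hu
    obtain ⟨B, hB⟩ := hu.exists_left_inv
    apply hψ
    rw [← Matrix.one_mulVec ψ, ← hB, ← Matrix.mulVec_mulVec, h, Matrix.mulVec_zero]
  have hnn : ∀ r ∈ spectrum ℝ H, 0 ≤ r := by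
    intro r hr
    rw [hH.isHermitian.spectrum_real_eq_range_eigenvalues] at hr
    obtain ⟨i, rfl⟩ := hr
    exact hH.eigenvalues_nonneg i
  exact IsLeast.csInf_eq ⟨h0, hnn⟩

/-- If the projectors `P k` have a common null vector, then all vectors in the ground space of
their sum are null vectors. -/
theorem mulVec_eq_zero_of_mem_groundSpace (s : Finset κ) (P : κ → Matrix ι ι ℂ)
    (hP : ∀ k, (P k).PosSemidef) {ψ : ι → ℂ} (hψ : ψ ≠ 0) (h : ∀ k ∈ s, (P k).mulVec ψ = 0)
    {φ : ι → ℂ} (hφ : φ ∈ groundSpace (∑ k ∈ s, P k)) {k : κ} (hk : k ∈ s) :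
    (P k).mulVec φ = 0 := by
  have hH : (∑ k ∈ s, P k).PosSemidef := Matrix.posSemidef_sum s fun k _ => hP k
  have hE : groundEnergy (∑ k ∈ s, P k) = 0 := by
    refine groundEnergy_eq_zero hH hψ ?_
    rw [Matrix.sum_mulVec]
    exact Finset.sum_eq_zero h
  rw [groundSpace, hE, Module.End.mem_eigenspace_iff, Complex.ofReal_zero, zero_smul,
    Matrix.toLin'_apply] at hφ
  -- The energy is a sum of nonnegative expectations, so each of them vanishes, and a positive
  -- semidefinite form vanishes only on null vectors.
  have hsum : ∑ k ∈ s, star φ ⬝ᵥ (P k).mulVec φ = 0 := by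
    rw [← dotProduct_sum, ← Matrix.sum_mulVec, hφ, dotProduct_zero]
  have hk0 := (Finset.sum_eq_zero_iff_of_nonneg
    (fun k _ => (hP k).dotProduct_mulVec_nonneg φ)).1 hsum k hk
  exact ((hP k).dotProduct_mulVec_zero_iff φ).1 hk0

end GroundSpace

/-! ### The frustration-free ground states of the Hamiltonian -/

section Tanner

set_option linter.unusedSectionVars false

open scoped ComplexOrder

variable {V : Type} [Fintype V] [DecidableEq V] {G : SimpleGraph V} [DecidableRel G.Adj]

/-- The string with ones on the two qubits of the edge `e`. -/
def edgeFlip (e : G.edgeSet) : Qubit G → Bit := fun p => if p.1.2 = e then 1 else 0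

/-- The two qubits of the edge `e` carry the same bit. -/
def EdgeConst (z : Qubit G → Bit) (e : G.edgeSet) : Prop :=
  ∀ p p' : Qubit G, p.1.2 = e → p'.1.2 = e → z p = z p'

theorem exists_qubit_of_edge (e : G.edgeSet) : ∃ p : Qubit G, p.1.2 = e := by
  obtain ⟨e, he⟩ := e
  induction e using Sym2.ind with
  | _ v w => exact ⟨⟨(v, ⟨s(v, w), he⟩), Sym2.mem_mk_left v w⟩, rfl⟩

theorem bit_eq_zero_or_one (b : Bit) : b = 0 ∨ b = 1 := by
  revert b; decide

theorem bit_add_self (b : Bit) : b + b = 0 := by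
  revert b; decide

theorem edgeConst_iff (z : Qubit G → Bit) (e : G.edgeSet) :
    EdgeConst z e ↔ (fun q : edgeQubits G e => z q) = 0 ∨ (fun q : edgeQubits G e => z q) = 1 := by
  have hmem : ∀ p : Qubit G, p ∈ edgeQubits G e ↔ p.1.2 = e := fun p => by simp [edgeQubits]
  constructor
  · intro h
    obtain ⟨p, hp⟩ := exists_qubit_of_edge e
    obtain h0 | h1 := bit_eq_zero_or_one (z p)
    · left; funext q; rw [Pi.zero_apply, ← h0]; exact h _ _ ((hmem _).1 q.2) hp
    · right; funext q; rw [Pi.one_apply, ← h1]; exact h _ _ ((hmem _).1 q.2) hp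
  · rintro (h | h) p p' hp hp'
    · exact (congrFun h ⟨p, (hmem p).2 hp⟩).trans (congrFun h ⟨p', (hmem p').2 hp'⟩).symm
    · exact (congrFun h ⟨p, (hmem p).2 hp⟩).trans (congrFun h ⟨p', (hmem p').2 hp'⟩).symm

open Classical in
-- The EPR vector has amplitude 1 on the two constant strings of the edge and 0 elsewhere, so the
-- projector averages over flipping the edge.
theorem eprProj_mulVec (e : G.edgeSet) (f : (Qubit G → Bit) → ℂ) (x : Qubit G → Bit) :
    (eprProj G e).mulVec f x =
      if EdgeConst x e then (f x + f (x + edgeFlip e)) / 2 else 0 := by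
  have hmem : ∀ p : Qubit G, p ∈ edgeQubits G e ↔ p.1.2 = e := fun p => by simp [edgeQubits]
  have hne : (0 : edgeQubits G e → Bit) ≠ 1 := by
    obtain ⟨p, hp⟩ := exists_qubit_of_edge e
    intro h
    exact zero_ne_one (congrFun h ⟨p, (hmem p).2 hp⟩)
  have hsum : ∀ F : (edgeQubits G e → Bit) → ℂ,
      ∑ w, eprVec G e w * F w = F 0 + F 1 := by
    intro F
    simp only [eprVec, Pi.add_apply, add_mul, Finset.sum_add_distrib]
    rw [Finset.sum_eq_single 0 (fun b _ hb => by rw [Pi.single_eq_of_ne hb, zero_mul]) (by simp),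
      Finset.sum_eq_single 1 (fun b _ hb => by rw [Pi.single_eq_of_ne hb, zero_mul]) (by simp)]
    simp
  have hstar : ∀ w, star (eprVec G e w) = eprVec G e w := by
    intro w
    simp only [eprVec, Pi.add_apply, Pi.single_apply]
    split_ifs <;> simp
  have hval : ∀ x : edgeQubits G e → Bit,
      eprVec G e x = if x = 0 ∨ x = 1 then 1 else 0 := by
    intro x
    simp only [eprVec, Pi.add_apply, Pi.single_apply]
    by_cases h0 : x = 0
    · subst h0; simp [hne]
    · by_cases h1 : x = 1
      · subst h1; simp [hne.symm]
      · simp [h0, h1]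
  have hmain : (eprProj G e).mulVec f x =
      (1 / 2) * (eprVec G e (fun q => x q) * (f (glue (edgeQubits G e) 0 x) +
        f (glue (edgeQubits G e) 1 x))) := by
    rw [eprProj, onQubits_mulVec, ← hsum fun w => f (glue (edgeQubits G e) w x), Finset.mul_sum,
      Finset.mul_sum]
    refine Finset.sum_congr rfl fun w _ => ?_
    rw [Matrix.smul_apply, ketbra, Matrix.vecMulVec_apply, Pi.star_apply, hstar, smul_eq_mul]
    ring
  rw [hmain, hval]
  split_ifs with h1 h2 h2
  · have hglue : ∀ b : edgeQubits G e → Bit, ∀ y : Qubit G → Bit,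
        (∀ p, p.1.2 ≠ e → y p = x p) → (∀ p : edgeQubits G e, y p = b p) →
        glue (edgeQubits G e) b x = y := by
      intro b y hy hy'
      funext p
      by_cases hp : p.1.2 = e
      · simp only [glue, hmem, hp, dif_pos]
        exact (hy' ⟨p, (hmem p).2 hp⟩).symm
      · simp only [glue, hmem, hp, dif_neg, not_false_eq_true]
        exact (hy p hp).symm
    have hflip : ∀ p : Qubit G, p.1.2 ≠ e → (x + edgeFlip e) p = x p := by
      intro p hp
      simp [edgeFlip, hp]
    have hflip' : ∀ p : edgeQubits G e, (x + edgeFlip e) p = x p + 1 := by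
      intro p
      simp [edgeFlip, (hmem _).1 p.2]
    obtain h0 | h0 := h1
    · rw [hglue 0 x (fun _ _ => rfl) (fun p => congrFun h0 p),
        hglue 1 (x + edgeFlip e) hflip (fun p => by
          rw [hflip', show x p = 0 from congrFun h0 p, zero_add]; rfl)]
      ring
    · rw [hglue 1 x (fun _ _ => rfl) (fun p => congrFun h0 p),
        hglue 0 (x + edgeFlip e) hflip (fun p => by
          rw [hflip', show x p = 1 from congrFun h0 p, bit_add_self]; rfl)]
      ring
  · exact absurd ((edgeConst_iff x e).2 h1) h2
  · exact absurd ((edgeConst_iff x e).1 h2) h1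
  · ring

theorem edgeFlip_add_self (e : G.edgeSet) : edgeFlip e + edgeFlip e = 0 := by
  funext p; exact bit_add_self _

theorem EdgeConst.add {x y : Qubit G → Bit} {e : G.edgeSet} (hx : EdgeConst x e)
    (hy : EdgeConst y e) : EdgeConst (x + y) e := fun p p' hp hp' => by
  rw [Pi.add_apply, Pi.add_apply, hx p p' hp hp', hy p p' hp hp']

theorem edgeConst_edgeFlip (e e' : G.edgeSet) : EdgeConst (edgeFlip e') e := fun p p' hp hp' => by
  rw [edgeFlip, edgeFlip, hp, hp']

/-- The vectors fixed by the projector onto an EPR pair. -/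
theorem eprProj_mulVec_eq_self_iff (e : G.edgeSet) (f : (Qubit G → Bit) → ℂ) :
    (eprProj G e).mulVec f = f ↔
      (∀ x, ¬ EdgeConst x e → f x = 0) ∧ ∀ x, f (x + edgeFlip e) = f x := by
  classical
  constructor
  · intro h
    have h0 : ∀ x, ¬ EdgeConst x e → f x = 0 := by
      intro x hx
      rw [← h, eprProj_mulVec, if_neg hx]
    refine ⟨h0, fun x => ?_⟩
    by_cases hx : EdgeConst x e
    · have h1 := congrFun h x
      rw [eprProj_mulVec, if_pos hx] at h1
      linear_combination 2 * h1
    · rw [h0 x hx, h0]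
      intro hc
      apply hx
      have := hc.add (edgeConst_edgeFlip e e)
      rwa [add_assoc, edgeFlip_add_self, add_zero] at this
  · rintro ⟨h0, h1⟩
    funext x
    rw [eprProj_mulVec]
    split_ifs with hx
    · rw [h1]; ring
    · exact (h0 x hx).symm

theorem eprProj_isHermitian (e : G.edgeSet) : (eprProj G e).IsHermitian := by
  have h : ((1 / 2 : ℂ) • ketbra (eprVec G e)).conjTranspose =
      (1 / 2 : ℂ) • ketbra (eprVec G e) := by
    ext x y
    simp only [Matrix.conjTranspose_apply, Matrix.smul_apply, ketbra, Matrix.vecMulVec_apply,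
      Pi.star_apply, smul_eq_mul, star_mul', star_star, mul_comm (eprVec G e y)]
    congr 1
    simp
  unfold Matrix.IsHermitian eprProj
  exact (onQubits_conjTranspose _ _).trans (congrArg (onQubits _) h)

variable (num : EdgeNumbering G) {d : ℕ} (hG : G.IsRegularOfDegree d)
  (C : Submodule Bit (Fin d → Bit)) (δ : ℝ)

open Classical in
/-- The eigenvalue of `Q_v` on a basis state. -/
noncomputable def vertexWeight (z : Qubit G → Bit) (v : V) : ℝ :=
  (if localString num hG z v ∈ C then 1 else 0) + δ

open Classical in
/-- The eigenvalue of `Q_v ⊗ Q_v'`, where `e = {v, v'}`, on a basis state. -/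
noncomputable def edgeWeight (z : Qubit G → Bit) (e : G.edgeSet) : ℝ :=
  ∏ v with v ∈ (e : Sym2 V), vertexWeight num hG C δ z v

/-- The eigenvalue of the tensor product of all the operators `Q_v` on a basis state. -/
noncomputable def totalWeight (z : Qubit G → Bit) : ℝ := ∏ v, vertexWeight num hG C δ z v

open Classical in
/-- The eigenvalue of the tensor product of the operators `Q_v` with `v` not in `e`. -/
noncomputable def outerWeight (z : Qubit G → Bit) (e : G.edgeSet) : ℝ :=
  ∏ v with v ∉ (e : Sym2 V), vertexWeight num hG C δ z v

theorem opQ_eq_diagonal (v : V) :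
    opQ num hG C δ v = Matrix.diagonal fun z => (vertexWeight num hG C δ z v : ℂ) := by
  classical
  ext x y
  simp only [opQ, projP, Matrix.add_apply, Matrix.smul_apply, Matrix.one_apply,
    Matrix.diagonal_apply, vertexWeight, smul_eq_mul]
  split_ifs <;> simp

theorem opQEdge_eq_diagonal (e : G.edgeSet) :
    opQEdge num hG C δ e = Matrix.diagonal fun z => (edgeWeight num hG C δ z e : ℂ) := by
  obtain ⟨e, he⟩ := e
  induction e using Sym2.ind with
  | _ v w =>
    have hvw : v ≠ w := G.ne_of_adj he
    have e1 : opQEdge num hG C δ ⟨s(v, w), he⟩ = opQ num hG C δ v * opQ num hG C δ w := rfl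
    rw [e1, opQ_eq_diagonal, opQ_eq_diagonal, Matrix.diagonal_mul_diagonal]
    congr 1
    funext z
    have : Finset.univ.filter (· ∈ s(v, w)) = {v, w} := by ext; simp
    rw [edgeWeight, this, Finset.prod_pair hvw]
    push_cast
    rfl

theorem edgeWeight_mul_outerWeight (z : Qubit G → Bit) (e : G.edgeSet) :
    edgeWeight num hG C δ z e * outerWeight num hG C δ z e = totalWeight num hG C δ z := by
  classical
  rw [edgeWeight, outerWeight, totalWeight]
  exact Finset.prod_filter_mul_prod_filter_not _ _ _

theorem localString_add (x y : Qubit G → Bit) (v : V) :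
    localString num hG (x + y) v = localString num hG x v + localString num hG y v := rfl

/-- Flipping an edge changes the local strings only at its endpoints, whose factors are left out of
this product. -/
theorem outerWeight_add_edgeFlip (z : Qubit G → Bit) (e : G.edgeSet) :
    outerWeight num hG C δ (z + edgeFlip e) e = outerWeight num hG C δ z e := by
  classical
  refine Finset.prod_congr rfl fun v hv => ?_
  have : localString num hG (z + edgeFlip e) v = localString num hG z v := by
    funext i
    rw [localString_add, Pi.add_apply, add_eq_left, localString, edgeFlip, if_neg]
    intro h
    exact (Finset.mem_filter.1 hv).2 (h ▸ mem_edgeAt num hG v i)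
  rw [vertexWeight, vertexWeight, this]

variable {δ}

theorem vertexWeight_ne_zero (h0 : δ ≠ 0) (h1 : 1 + δ ≠ 0) (z : Qubit G → Bit) (v : V) :
    vertexWeight num hG C δ z v ≠ 0 := by
  rw [vertexWeight]
  split_ifs
  · exact h1
  · rwa [zero_add]

theorem totalWeight_ne_zero (h0 : δ ≠ 0) (h1 : 1 + δ ≠ 0) (z : Qubit G → Bit) :
    totalWeight num hG C δ z ≠ 0 :=
  Finset.prod_ne_zero_iff.2 fun v _ => vertexWeight_ne_zero num hG C h0 h1 z v

theorem opQEdge_isUnit_det (h0 : δ ≠ 0) (h1 : 1 + δ ≠ 0) (e : G.edgeSet) :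
    IsUnit (opQEdge num hG C δ e).det := by
  rw [opQEdge_eq_diagonal, Matrix.det_diagonal, isUnit_iff_ne_zero]
  refine Finset.prod_ne_zero_iff.2 fun z _ => ?_
  exact_mod_cast Finset.prod_ne_zero_iff.2 fun v _ => vertexWeight_ne_zero num hG C h0 h1 z v

theorem opG_isHermitian (e : G.edgeSet) : (opG num hG C δ e).IsHermitian := by
  have hD : (opQEdge num hG C δ e).IsHermitian := by
    rw [opQEdge_eq_diagonal]
    refine Matrix.isHermitian_diagonal_of_self_adjoint _ ?_
    rw [IsSelfAdjoint]
    funext z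
    simp
  have h1 := (Matrix.isHermitian_one.sub (eprProj_isHermitian e) :
    (1 - eprProj G e).IsHermitian)
  have := Matrix.isHermitian_conjTranspose_mul_mul (opQEdge num hG C δ e)⁻¹ h1
  rwa [hD.inv.eq] at this

/-- The null vectors of `h_e`. -/
theorem localTerm_mulVec_eq_zero_iff (h0 : δ ≠ 0) (h1 : 1 + δ ≠ 0) (e : G.edgeSet)
    (φ : (Qubit G → Bit) → ℂ) :
    (localTerm num hG C δ e).mulVec (fun z => (totalWeight num hG C δ z : ℂ) * φ z) = 0 ↔
      (∀ x, ¬ EdgeConst x e → φ x = 0) ∧ ∀ x, φ (x + edgeFlip e) = φ x := by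
  have hdet := opQEdge_isUnit_det num hG C h0 h1 e
  have hr : ∀ x, outerWeight num hG C δ x e ≠ 0 := fun x =>
    Finset.prod_ne_zero_iff.2 fun v _ => vertexWeight_ne_zero num hG C h0 h1 x v
  rw [localTerm, imageProj_mulVec_eq_zero_iff (opG_isHermitian num hG C e)]
  -- The endpoint factors of the total weight cancel one inverse in `g_e`; the other inverse is
  -- invertible and does not affect the kernel.
  have e1 : (fun z => (totalWeight num hG C δ z : ℂ) * φ z) =
      (opQEdge num hG C δ e).mulVec fun z => (outerWeight num hG C δ z e : ℂ) * φ z := by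
    funext z
    rw [opQEdge_eq_diagonal, Matrix.mulVec_diagonal, ← edgeWeight_mul_outerWeight num hG C δ z e]
    push_cast
    ring
  have e2 : (opG num hG C δ e).mulVec (fun z => (totalWeight num hG C δ z : ℂ) * φ z) = 0 ↔
      (eprProj G e).mulVec (fun z => (outerWeight num hG C δ z e : ℂ) * φ z) =
        fun z => (outerWeight num hG C δ z e : ℂ) * φ z := by
    rw [e1, opG, Matrix.mulVec_mulVec, mul_assoc, Matrix.nonsing_inv_mul _ hdet, mul_one,
      ← Matrix.mulVec_mulVec, Matrix.sub_mulVec, Matrix.one_mulVec]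
    constructor
    · intro h
      have := congrArg (opQEdge num hG C δ e).mulVec h
      rw [Matrix.mulVec_mulVec, Matrix.mul_nonsing_inv _ hdet, Matrix.one_mulVec,
        Matrix.mulVec_zero, sub_eq_zero] at this
      exact this.symm
    · intro h
      rw [h, sub_self, Matrix.mulVec_zero]
  rw [e2, eprProj_mulVec_eq_self_iff]
  refine and_congr (forall_congr' fun x => imp_congr Iff.rfl ?_) (forall_congr' fun x => ?_)
  · rw [mul_eq_zero, or_iff_right]
    exact_mod_cast hr x
  · rw [outerWeight_add_edgeFlip]
    exact mul_right_inj' (by exact_mod_cast hr x)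

/-- The amplitudes of the ground states of the Hamiltonian. -/
theorem IsGroundState.exists_amplitude (h0 : δ ≠ 0) (h1 : 1 + δ ≠ 0) {E₁ : Finset G.edgeSet}
    {A : Type} [Fintype A] [DecidableEq A] {Γ : (Qubit G ⊕ A → Bit) → ℂ}
    (hΓ : IsGroundState (hamiltonian num hG C δ E₁) Γ) :
    ∃ φ : (A → Bit) → (Qubit G → Bit) → ℂ,
      (∀ w z, Γ (Sum.elim z w) = totalWeight num hG C δ z * φ w z) ∧
      (∀ w, ∀ e ∈ E₁, ∀ x, ¬ EdgeConst x e → φ w x = 0) ∧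
      ∀ w, ∀ e ∈ E₁, ∀ x, φ w (x + edgeFlip e) = φ w x := by
  classical
  have hq : ∀ z, (totalWeight num hG C δ z : ℂ) ≠ 0 := fun z => by
    exact_mod_cast totalWeight_ne_zero num hG C h0 h1 z
  -- A common null vector of all the local terms: it shows that the ground energy is 0.
  set T : (Qubit G → Bit) → ℂ := fun z => (totalWeight num hG C δ z : ℂ) *
    (if ∀ e, EdgeConst z e then 1 else 0) with hT
  have hT0 : T ≠ 0 := by
    intro h
    have := congrFun h 0
    rw [hT] at this
    simp only [Pi.zero_apply, mul_eq_zero, hq, false_or] at this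
    have hc : ∀ e : G.edgeSet, EdgeConst (0 : Qubit G → Bit) e := fun e p p' _ _ => rfl
    rw [if_pos hc] at this
    exact one_ne_zero this
  have hTe : ∀ e ∈ E₁, (localTerm num hG C δ e).mulVec T = 0 := by
    intro e _
    rw [hT, localTerm_mulVec_eq_zero_iff num hG C h0 h1]
    constructor
    · intro x hx
      rw [if_neg fun h => hx (h e)]
    · intro x
      have : (∀ e', EdgeConst (x + edgeFlip e) e') ↔ ∀ e', EdgeConst x e' := by
        refine forall_congr' fun e' => ⟨fun h => ?_, fun h => h.add (edgeConst_edgeFlip _ _)⟩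
        have := h.add (edgeConst_edgeFlip e' e)
        rwa [add_assoc, edgeFlip_add_self, add_zero] at this
      simp only [this]
  set M : Matrix (Qubit G → Bit) (A → Bit) ℂ := fun z w => Γ (Sum.elim z w) with hM
  have hρ : reducedState Γ = M * M.conjTranspose := by
    ext x y
    rw [Matrix.mul_apply]
    rfl
  -- The reduced state is M M*, and X M M* = 0 forces X M = 0. So the local terms annihilate each
  -- column of `M`, that is, the state for each ancilla string.
  have hker : ∀ e ∈ E₁, localTerm num hG C δ e * M = 0 := by
    intro e he
    rw [← Matrix.mul_self_mul_conjTranspose_eq_zero, ← hρ]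
    ext x y
    have hmem : (reducedState Γ).mulVec (Pi.single y 1) ∈
        groundSpace (hamiltonian num hG C δ E₁) :=
      hΓ.2 ⟨Pi.single y 1, rfl⟩
    have := mulVec_eq_zero_of_mem_groundSpace E₁ (localTerm num hG C δ)
      (fun e => imageProj_posSemidef _) hT0 hTe hmem he
    rw [Matrix.mulVec_mulVec, Matrix.mulVec_single_one] at this
    exact congrFun this x
  refine ⟨fun w z => Γ (Sum.elim z w) / totalWeight num hG C δ z, ?_, ?_⟩
  · intro w z
    rw [mul_div_cancel₀ _ (hq z)]
  · have hall : ∀ w, ∀ e ∈ E₁, _ := fun w e he =>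
      (localTerm_mulVec_eq_zero_iff num hG C h0 h1 e
        fun z => Γ (Sum.elim z w) / totalWeight num hG C δ z).1 (by
        funext x
        have := congrFun (congrFun (hker e he) x) w
        rw [Matrix.mul_apply] at this
        rw [Matrix.mulVec, dotProduct, Pi.zero_apply, ← show (0 : Matrix (Qubit G → Bit)
          (A → Bit) ℂ) x w = 0 from rfl, ← this]
        refine Finset.sum_congr rfl fun z _ => ?_
        rw [mul_div_cancel₀ _ (hq z)])
    exact ⟨fun w e he => (hall w e he).1, fun w e he => (hall w e he).2⟩

end Tanner

/-! ### Counting qubits, edges and vertices -/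

section Counting

set_option linter.unusedSectionVars false

variable {V : Type} [Fintype V] [DecidableEq V] {G : SimpleGraph V} [DecidableRel G.Adj]
variable (num : EdgeNumbering G) {d : ℕ} (hG : G.IsRegularOfDegree d)

theorem edgeAt_injective (v : V) : Function.Injective (edgeAt num hG v) := fun _ _ h =>
  (Finset.orderEmbOfFin _ _).injective (num.symm.injective h)

theorem exists_edgeAt_eq (v : V) (e : G.edgeSet) (h : v ∈ (e : Sym2 V)) :
    ∃ i, edgeAt num hG v i = e := by
  have h1 : num e ∈ Set.range (((incidentEdges G v).map num.toEmbedding).orderEmbOfFin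
      (by rw [Finset.card_map, card_incidentEdges G hG v] : _ = d)) := by
    rw [Finset.range_orderEmbOfFin]
    simpa [incidentEdges] using h
  obtain ⟨i, hi⟩ := h1
  exact ⟨i, by rw [edgeAt, hi, num.symm_apply_apply]⟩

/-- The qubits at `v` are numbered by `Fin d`. -/
noncomputable def qubitEquiv : V × Fin d ≃ Qubit G :=
  Equiv.ofBijective (fun p => ⟨(p.1, edgeAt num hG p.1 p.2), mem_edgeAt num hG p.1 p.2⟩) (by
    constructor
    · rintro ⟨v, i⟩ ⟨w, j⟩ h
      simp only [Subtype.mk.injEq, Prod.mk.injEq] at h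
      obtain ⟨rfl, h⟩ := h
      rw [edgeAt_injective num hG v h]
    · rintro ⟨⟨v, e⟩, h⟩
      obtain ⟨i, rfl⟩ := exists_edgeAt_eq num hG v e h
      exact ⟨(v, i), rfl⟩)

theorem localString_eq (z : Qubit G → Bit) (v : V) (i : Fin d) :
    localString num hG z v i = z (qubitEquiv num hG (v, i)) := rfl

theorem card_qubit (num : EdgeNumbering G) (hG : G.IsRegularOfDegree d) :
    Fintype.card (Qubit G) = Fintype.card V * d := by
  rw [← Fintype.card_congr (qubitEquiv num hG), Fintype.card_prod, Fintype.card_fin]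

theorem card_ne_zero_eq_sum_hammingNorm (z : Qubit G → Bit) :
    (Finset.univ.filter fun p => z p ≠ 0).card = ∑ v, hammingNorm (localString num hG z v) := by
  have h1 : (Finset.univ.filter fun p => z p ≠ 0).card =
      (Finset.univ.filter fun q : V × Fin d => z (qubitEquiv num hG q) ≠ 0).card := by
    symm
    refine Finset.card_bij (fun q _ => qubitEquiv num hG q) ?_ ?_ ?_
    · intro q hq
      simpa using hq
    · intro q _ q' _ h
      exact (qubitEquiv num hG).injective h
    · intro p hp
      exact ⟨(qubitEquiv num hG).symm p, by simpa using hp, by simp⟩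
  rw [h1, Finset.card_filter, Fintype.sum_prod_type]
  refine Finset.sum_congr rfl fun v _ => ?_
  rw [← Finset.card_filter]
  rfl

theorem card_edgeQubits_le (e : G.edgeSet) : (edgeQubits G e).card ≤ 2 := by
  obtain ⟨e, he⟩ := e
  induction e using Sym2.ind with
  | _ v w =>
    refine (Finset.card_le_card_of_injOn (fun p : Qubit G => p.1.1) (t := {v, w}) ?_ ?_).trans
      Finset.card_le_two
    · intro p hp
      have h1 : p.1.2 = ⟨s(v, w), he⟩ := by simpa [edgeQubits] using hp
      have h2 := p.2
      rw [h1] at h2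
      simpa using h2
    · intro p hp q hq h
      have h1 : p.1.2 = ⟨s(v, w), he⟩ := by simpa [edgeQubits] using hp
      have h2 : q.1.2 = ⟨s(v, w), he⟩ := by simpa [edgeQubits] using hq
      exact Subtype.ext (Prod.ext h (h1.trans h2.symm))

theorem card_qubits_on_edges_le (F : Finset G.edgeSet) :
    (Finset.univ.filter fun p : Qubit G => p.1.2 ∈ F).card ≤ 2 * F.card := by
  have : (Finset.univ.filter fun p : Qubit G => p.1.2 ∈ F) ⊆ F.biUnion (edgeQubits G) := by
    intro p hp
    exact Finset.mem_biUnion.2 ⟨p.1.2, (Finset.mem_filter.1 hp).2, by simp [edgeQubits]⟩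
  rw [mul_comm]
  exact (Finset.card_le_card this).trans
    (Finset.card_biUnion_le_card_mul _ _ 2 fun e _ => card_edgeQubits_le e)

/-- The vertices on an edge of `F`. -/
def coveredVertices (F : Finset G.edgeSet) : Finset V :=
  (Finset.univ.filter fun p : Qubit G => p.1.2 ∈ F).image fun p => p.1.1

theorem card_coveredVertices_le (F : Finset G.edgeSet) :
    (coveredVertices F).card ≤ 2 * F.card :=
  Finset.card_image_le.trans (card_qubits_on_edges_le F)

theorem two_mul_card_edgeSet (hG : G.IsRegularOfDegree d) :
    2 * Fintype.card G.edgeSet = Fintype.card V * d := by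
  have := G.sum_degrees_eq_twice_card_edges
  rw [Finset.sum_congr rfl fun v _ => hG v, Finset.sum_const, Finset.card_univ, smul_eq_mul,
    SimpleGraph.edgeFinset_card] at this
  exact this.symm

end Counting

/-! ### The expansion of the Tanner code -/

section Code

theorem codeDist_le_hammingNorm {d : ℕ} {C : Submodule Bit (Fin d → Bit)} {x : Fin d → Bit}
    (hx : x ∈ C) (h0 : x ≠ 0) : codeDist C ≤ hammingNorm x :=
  Nat.sInf_le ⟨x, hx, 0, C.zero_mem, h0, hammingDist_zero_right x⟩

/-- The zero code must be excluded: its set of distances is empty and the infimum takes the default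
value 0. -/
theorem exists_ne_of_codeDist {d : ℕ} {C : Submodule Bit (Fin d → Bit)} (hC : C ≠ ⊥) :
    ∃ x ∈ C, ∃ y ∈ C, x ≠ y ∧ hammingDist x y = codeDist C := by
  obtain ⟨x, hx, h0⟩ := C.ne_bot_iff.1 hC
  exact Nat.sInf_mem (s := {w | ∃ x ∈ C, ∃ y ∈ C, x ≠ y ∧ hammingDist x y = w})
    ⟨_, x, hx, 0, C.zero_mem, h0, rfl⟩

theorem codeDist_pos {d : ℕ} {C : Submodule Bit (Fin d → Bit)} (hC : C ≠ ⊥) :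
    0 < codeDist C := by
  obtain ⟨x, _, y, _, hxy, h⟩ := exists_ne_of_codeDist hC
  rw [← h]
  exact hammingDist_pos.2 hxy

theorem codeDist_le {d : ℕ} {C : Submodule Bit (Fin d → Bit)} (hC : C ≠ ⊥) :
    codeDist C ≤ d := by
  obtain ⟨x, _, y, _, _, h⟩ := exists_ne_of_codeDist hC
  rw [← h]
  exact hammingDist_le_card_fintype.trans (by simp)

set_option linter.unusedSectionVars false

variable {V : Type} [Fintype V] [DecidableEq V] {G : SimpleGraph V} [DecidableRel G.Adj]
variable (num : EdgeNumbering G) {d : ℕ} (hG : G.IsRegularOfDegree d)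
  (C : Submodule Bit (Fin d → Bit))

open Classical in
/-- The vertices at which the local string is not in the code. -/
noncomputable def violated (z : Qubit G → Bit) : Finset V :=
  Finset.univ.filter fun v => localString num hG z v ∉ C

/-- The vertices at which the local string does not vanish. -/
noncomputable def activeVertices (z : Qubit G → Bit) : Finset V :=
  Finset.univ.filter fun v => localString num hG z v ≠ 0

theorem mem_violated (z : Qubit G → Bit) (v : V) :
    v ∈ violated num hG C z ↔ localString num hG z v ∉ C := by simp [violated]

theorem mem_activeVertices (z : Qubit G → Bit) (v : V) :
    v ∈ activeVertices num hG z ↔ localString num hG z v ≠ 0 := by simp [activeVertices]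

theorem mem_activeVertices_of_ne_zero (z : Qubit G → Bit) (p : Qubit G) (hp : z p ≠ 0) :
    p.1.1 ∈ activeVertices num hG z := by
  rw [mem_activeVertices]
  intro h
  obtain ⟨⟨v, i⟩, rfl⟩ := (qubitEquiv num hG).surjective p
  exact hp (congrFun h i)

/-- An active vertex that is not violated carries a nonzero codeword, hence at least as many ones as
the distance. If violated vertices outnumber active ones, the subtraction truncates to 0. -/
theorem codeDist_mul_le_card_ne_zero (z : Qubit G → Bit) :
    codeDist C * ((activeVertices num hG z).card - (violated num hG C z).card) ≤
      (Finset.univ.filter fun p => z p ≠ 0).card := by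
  rw [card_ne_zero_eq_sum_hammingNorm num hG]
  calc codeDist C * ((activeVertices num hG z).card - (violated num hG C z).card)
      ≤ codeDist C * (activeVertices num hG z \ violated num hG C z).card :=
        Nat.mul_le_mul_left _ (Finset.le_card_sdiff _ _)
    _ = ∑ v ∈ activeVertices num hG z \ violated num hG C z, codeDist C := by
        rw [Finset.sum_const, smul_eq_mul, mul_comm]
    _ ≤ ∑ v ∈ activeVertices num hG z \ violated num hG C z,
          hammingNorm (localString num hG z v) := by
        refine Finset.sum_le_sum fun v hv => ?_
        rw [Finset.mem_sdiff, mem_violated, not_not, mem_activeVertices] at hv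
        exact codeDist_le_hammingNorm hv.2 hv.1
    _ ≤ ∑ v, hammingNorm (localString num hG z v) :=
        Finset.sum_le_sum_of_subset (Finset.subset_univ _)

/-- On an edge of `E₁` a bit 1 forces its partner to be 1, so both endpoints are active and the
qubit gives an ordered pair of adjacent active vertices. Each removed edge contributes at most two
qubits. -/
theorem card_ne_zero_le {E₁ : Finset G.edgeSet} {z : Qubit G → Bit}
    (hz : ∀ e ∈ E₁, EdgeConst z e) :
    (Finset.univ.filter fun p => z p ≠ 0).card ≤
      ∑ v ∈ activeVertices num hG z, ((activeVertices num hG z).filter fun w => G.Adj v w).card +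
        2 * E₁ᶜ.card := by
  rw [← Finset.card_filter_add_card_filter_not (fun p : Qubit G => p.1.2 ∈ E₁)]
  refine Nat.add_le_add ?_ ?_
  · rw [← Finset.card_sigma]
    refine Finset.card_le_card_of_injOn
      (fun p : Qubit G => (⟨p.1.1, Sym2.Mem.other p.2⟩ : Σ _ : V, V)) ?_ ?_
    · intro p hp
      simp only [Finset.coe_filter, Finset.mem_filter, Finset.mem_univ, true_and,
        Set.mem_ofPred_eq] at hp
      have hs : s(p.1.1, Sym2.Mem.other p.2) = (p.1.2 : Sym2 V) := Sym2.other_spec p.2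
      have hadj : G.Adj p.1.1 (Sym2.Mem.other p.2) := by
        rw [← SimpleGraph.mem_edgeSet, hs]; exact p.1.2.2
      have hother := mem_activeVertices_of_ne_zero num hG z
        ⟨(Sym2.Mem.other p.2, p.1.2), Sym2.other_mem p.2⟩
        (fun h => hp.1 ((hz _ hp.2 p ⟨(Sym2.Mem.other p.2, p.1.2), Sym2.other_mem p.2⟩
          rfl rfl).trans h))
      simp only [Finset.coe_sigma, Set.mem_sigma_iff, Finset.mem_coe, Finset.mem_filter]
      exact ⟨mem_activeVertices_of_ne_zero num hG z p hp.1, hother, hadj⟩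
    · intro p _ q _ h
      simp only [Sigma.mk.injEq, heq_eq_eq] at h
      refine Subtype.ext (Prod.ext h.1 (Subtype.ext ?_))
      rw [← Sym2.other_spec p.2, ← Sym2.other_spec q.2, h.2, h.1]
  · refine (Finset.card_le_card ?_).trans (card_qubits_on_edges_le E₁ᶜ)
    intro p hp
    simp only [Finset.mem_filter, Finset.mem_univ, true_and, Finset.mem_compl] at hp ⊢
    exact hp.2

/-- The number of active vertices of an approximate codeword satisfies a quadratic inequality. -/
theorem card_activeVertices_quadratic (hV : 2 ≤ Fintype.card V) {E₁ : Finset G.edgeSet}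
    {z : Qubit G → Bit} (hz : ∀ e ∈ E₁, EdgeConst z e) :
    (codeDist C : ℝ) * ((activeVertices num hG z).card - (violated num hG C z).card) ≤
      d * ((activeVertices num hG z).card : ℝ) ^ 2 / Fintype.card V +
        secondEigenvalue G * (activeVertices num hG z).card + 2 * E₁ᶜ.card := by
  have h1 := codeDist_mul_le_card_ne_zero num hG C z
  have h2 := card_ne_zero_le num hG hz
  have h3 := card_adj_le_of_regular G hG hV (activeVertices num hG z)
  have h4 : (codeDist C : ℝ) * ((activeVertices num hG z).card - (violated num hG C z).card) ≤
      ((Finset.univ.filter fun p => z p ≠ 0).card : ℝ) := by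
    refine le_trans ?_ (Nat.cast_le.2 h1)
    rw [Nat.cast_mul]
    gcongr
    have : (activeVertices num hG z).card ≤
        (activeVertices num hG z).card - (violated num hG C z).card +
          (violated num hG C z).card := by omega
    have := (Nat.cast_le (α := ℝ)).2 this
    rw [Nat.cast_add] at this
    linarith
  have h5 := (Nat.cast_le (α := ℝ)).2 h2
  rw [Nat.cast_add, Nat.cast_mul] at h5
  push_cast at h3 h5 ⊢
  linarith

/-- The strings that are constant on the edges in `E₁` and vanish on the other edges. -/
def edgeStrings (E₁ : Finset G.edgeSet) : Submodule Bit (Qubit G → Bit) where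
  carrier := {y | (∀ e ∈ E₁, EdgeConst y e) ∧ ∀ p : Qubit G, p.1.2 ∉ E₁ → y p = 0}
  zero_mem' := ⟨fun _ _ _ _ _ _ => rfl, fun _ _ => rfl⟩
  add_mem' := fun ha hb => ⟨fun e he => (ha.1 e he).add (hb.1 e he), fun p hp => by
    rw [Pi.add_apply, ha.2 p hp, hb.2 p hp, add_zero]⟩
  smul_mem' := fun c a ha => ⟨fun e he p p' hp hp' => by
    rw [Pi.smul_apply, Pi.smul_apply, ha.1 e he p p' hp hp'], fun p hp => by
    rw [Pi.smul_apply, ha.2 p hp, smul_zero]⟩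

/-- The Tanner code, restricted to the edges in `E₁`. -/
def tannerCode (E₁ : Finset G.edgeSet) : Submodule Bit (Qubit G → Bit) where
  carrier := {y | y ∈ edgeStrings E₁ ∧ ∀ v, localString num hG y v ∈ C}
  zero_mem' := ⟨zero_mem _, fun _ => C.zero_mem⟩
  add_mem' := fun ha hb => ⟨add_mem ha.1 hb.1, fun v => C.add_mem (ha.2 v) (hb.2 v)⟩
  smul_mem' := fun c _ ha => ⟨Submodule.smul_mem _ c ha.1, fun v => C.smul_mem c (ha.2 v)⟩

/-- The string on the qubits given by an assignment of bits to the edges in `E₁`. -/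
def spread (E₁ : Finset G.edgeSet) : (E₁ → Bit) →ₗ[Bit] (Qubit G → Bit) where
  toFun s := fun p => if h : p.1.2 ∈ E₁ then s ⟨p.1.2, h⟩ else 0
  map_add' s s' := by
    funext p
    by_cases h : p.1.2 ∈ E₁ <;> simp [h]
  map_smul' c s := by
    funext p
    by_cases h : p.1.2 ∈ E₁ <;> simp [h]

theorem spread_mem_edgeStrings {E₁ : Finset G.edgeSet} (s : E₁ → Bit) :
    spread E₁ s ∈ edgeStrings E₁ := by
  refine ⟨fun e he p p' hp hp' => ?_, fun p hp => ?_⟩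
  · subst hp
    simp [spread, hp', he]
  · simp [spread, hp]

/-- Dimension count: one free bit per edge of `E₁` against d minus the rank of `C` parity checks at
each vertex. -/
theorem exists_mem_tannerCode_ne_zero {E₁ : Finset G.edgeSet}
    (h : Fintype.card V * (d - Module.finrank Bit C) < E₁.card) :
    ∃ k ∈ tannerCode num hG C E₁, k ≠ 0 := by
  have : Fact (Nat.Prime 2) := ⟨Nat.prime_two⟩
  let T : (Qubit G → Bit) →ₗ[Bit] (V → (Fin d → Bit) ⧸ C) :=
    { toFun := fun y v => C.mkQ (localString num hG y v)
      map_add' := fun _ _ => rfl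
      map_smul' := fun _ _ => rfl }
  have hlt : Module.finrank Bit (V → (Fin d → Bit) ⧸ C) < Module.finrank Bit (E₁ → Bit) := by
    rw [Module.finrank_pi_fintype, Finset.sum_const, Finset.card_univ, smul_eq_mul,
      Module.finrank_fintype_fun_eq_card, Submodule.finrank_quotient, Module.finrank_fin_fun,
      Fintype.card_coe]
    exact h
  obtain ⟨s, hs, hs0⟩ := (Submodule.ne_bot_iff _).1
    (LinearMap.ker_ne_bot_of_finrank_lt (f := T ∘ₗ spread E₁) hlt)
  refine ⟨spread E₁ s, ⟨spread_mem_edgeStrings s, fun v => ?_⟩, ?_⟩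
  · rw [LinearMap.mem_ker] at hs
    have := congrFun hs v
    exact (Submodule.Quotient.mk_eq_zero C).1 this
  · intro h0
    apply hs0
    funext e
    obtain ⟨p, hp⟩ := exists_qubit_of_edge e.1
    have := congrFun h0 p
    simpa [spread, hp] using this

end Code

/-! ### Concentration of the number of violated vertices -/

section Tail

/-- Exponential moment bound: each term is multiplied by (cb)^(|B| - b) ≥ 1, and the sum is extended
to all subsets, where it is the binomial (1 + cbs)^n ≤ e^b. -/
theorem sum_pow_card_gt_le {V : Type} [Fintype V] [DecidableEq V] {b s c : ℝ} (hc : 0 < c)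
    (hb : 1 ≤ c * b) (hs : 0 ≤ s) (hsn : c * s * Fintype.card V ≤ 1) :
    ∑ B : Finset V with b < (B.card : ℝ), s ^ B.card ≤ (c * b) ^ (-b) * Real.exp b := by
  have hb0 : 0 < b := by
    by_contra h
    have : c * b ≤ 0 := mul_nonpos_of_nonneg_of_nonpos hc.le (not_lt.1 h)
    linarith
  have hθ : 0 < c * b := by positivity
  calc ∑ B : Finset V with b < (B.card : ℝ), s ^ B.card
      ≤ ∑ B : Finset V with b < (B.card : ℝ), (c * b) ^ (-b) * (c * b * s) ^ B.card := by
        refine Finset.sum_le_sum fun B hB => ?_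
        have hB := (Finset.mem_filter.1 hB).2
        rw [mul_pow, ← mul_assoc, ← Real.rpow_natCast (c * b), ← Real.rpow_add hθ]
        refine le_mul_of_one_le_left (by positivity) ?_
        exact Real.one_le_rpow hb (by linarith)
    _ ≤ ∑ B : Finset V, (c * b) ^ (-b) * (c * b * s) ^ B.card :=
        Finset.sum_le_sum_of_subset_of_nonneg (Finset.subset_univ _)
          fun _ _ _ => by positivity
    _ = (c * b) ^ (-b) * (c * b * s + 1) ^ Fintype.card V := by
        rw [← Finset.mul_sum, ← Fintype.sum_pow_mul_eq_add_pow]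
        simp
    _ ≤ (c * b) ^ (-b) * Real.exp b := by
        gcongr
        calc (c * b * s + 1) ^ Fintype.card V ≤ Real.exp (c * b * s) ^ Fintype.card V := by
              gcongr
              exact Real.add_one_le_exp _
          _ = Real.exp (Fintype.card V * (c * b * s)) := (Real.exp_nat_mul _ _).symm
          _ ≤ Real.exp b := by
              rw [Real.exp_le_exp]
              nlinarith

/-- In logarithms, u(d log 2 + log 9000 + log n) must be beaten by b(log 9000 + log b - 1) with log
10 to spare. The bounds on `u` and `n` make the former at most 5.09 b + (b log b)/3, while log 9000
- 1 exceeds 8. -/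
theorem two_pow_mul_rpow_neg_le {n b : ℝ} {d u : ℕ} (hd : 0 < d) (hn : 0 < n) (hb : 1 ≤ b)
    (hu : (u : ℝ) ≤ b / (3 * d)) (hnb : n ≤ 100 * b * d ^ 2) :
    (2 ^ d * (9000 * n)) ^ u * ((9000 * b) ^ (-b) * Real.exp b) ≤ 1 / 10 := by
  have hd' : (1 : ℝ) ≤ d := by exact_mod_cast hd
  have hb0 : 0 < b := by linarith
  have l2 := Real.log_two_gt_d9
  have l2' := Real.log_two_lt_d9
  have hpos : 0 < (2 ^ d * (9000 * n)) ^ u * ((9000 * b) ^ (-b) * Real.exp b) := by positivity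
  rw [← Real.log_le_log_iff hpos (by norm_num), Real.log_mul (by positivity) (by positivity),
    Real.log_mul (by positivity) (by positivity), Real.log_exp, Real.log_rpow (by positivity),
    Real.log_pow, Real.log_mul (by positivity) (by positivity), Real.log_pow,
    Real.log_mul (by positivity) (by positivity), Real.log_mul (by positivity) (by positivity)]
  have h9 : 13 * Real.log 2 ≤ Real.log 9000 := by
    rw [show (13 : ℝ) = ((13 : ℕ) : ℝ) by norm_num, ← Real.log_pow]
    exact Real.log_le_log (by norm_num) (by norm_num)
  have h9' : Real.log 9000 ≤ 14 * Real.log 2 := by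
    rw [show (14 : ℝ) = ((14 : ℕ) : ℝ) by norm_num, ← Real.log_pow]
    exact Real.log_le_log (by norm_num) (by norm_num)
  have h100 : Real.log 100 ≤ 7 * Real.log 2 := by
    rw [show (7 : ℝ) = ((7 : ℕ) : ℝ) by norm_num, ← Real.log_pow]
    exact Real.log_le_log (by norm_num) (by norm_num)
  have h10 : -(4 * Real.log 2) ≤ Real.log (1 / 10) := by
    rw [show (4 : ℝ) = ((4 : ℕ) : ℝ) by norm_num, ← Real.log_pow, ← Real.log_inv]
    exact Real.log_le_log (by norm_num) (by norm_num)
  have hld : Real.log d ≤ d - 1 := Real.log_le_sub_one_of_pos (by positivity)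
  have hlb : 0 ≤ Real.log b := Real.log_nonneg hb
  have hln : Real.log n ≤ Real.log 100 + Real.log b + 2 * Real.log d := by
    have := Real.log_le_log hn hnb
    rwa [Real.log_mul (by positivity) (by positivity), Real.log_mul (by positivity)
      (by positivity), Real.log_pow, Nat.cast_ofNat] at this
  set X := d * Real.log 2 + (Real.log 9000 + Real.log n) with hX
  -- d log 2 + (14 + 7) log 2 + 2(d - 1) is at most 15.27 d, because d ≥ 1.
  have hXle : X ≤ d * 5.09 * 3 + Real.log b := by
    rw [hX]
    nlinarith
  have hY : 0 ≤ d * 5.09 * 3 + Real.log b := by positivity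
  have hu2 : (u : ℝ) * X ≤ b * 5.09 + b * Real.log b / 3 := by
    calc (u : ℝ) * X ≤ u * (d * 5.09 * 3 + Real.log b) := by gcongr
      _ ≤ b / (3 * d) * (d * 5.09 * 3 + Real.log b) := by gcongr
      _ = b * 5.09 + b * Real.log b / 3 / d := by field_simp
      _ ≤ b * 5.09 + b * Real.log b / 3 := by
          exact add_le_add le_rfl (div_le_self (by positivity) hd')
  have h3 : 0 ≤ b * Real.log b := by positivity
  nlinarith

/-- The bound on the relative weight of the strings with more than `b` violated vertices. -/
theorem sum_two_pow_mul_pow_le {V : Type} [Fintype V] [DecidableEq V] {b a : ℝ} {d u : ℕ}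
    (hd : 0 < d) (hV : 0 < Fintype.card V) (hb : 1 ≤ b) (hu : (u : ℝ) ≤ b / (3 * d))
    (hnb : (Fintype.card V : ℝ) ≤ 100 * b * d ^ 2) (ha : 0 < a)
    (han : 2 ^ d * a * (9000 * Fintype.card V) ≤ 1) :
    ∑ B : Finset V with b < (B.card : ℝ), (2 ^ d * a) ^ B.card ≤ 1 / 10 * a ^ u := by
  have hn : (0 : ℝ) < Fintype.card V := by exact_mod_cast hV
  set n : ℝ := (Fintype.card V : ℝ) with hn'
  have hd' : (1 : ℝ) ≤ d := by exact_mod_cast hd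
  have hub : (u : ℝ) ≤ b := hu.trans (div_le_self (by linarith) (by linarith))
  set s : ℝ := (9000 * n)⁻¹ with hs
  have hs0 : 0 < s := by positivity
  have has : 2 ^ d * a ≤ s := by
    rw [hs, ← one_div, le_div_iff₀ (by positivity)]
    exact han
  calc ∑ B : Finset V with b < (B.card : ℝ), (2 ^ d * a) ^ B.card
      ≤ ∑ B : Finset V with b < (B.card : ℝ),
          (a ^ u * (2 ^ d * (9000 * n)) ^ u) * s ^ B.card := by
        refine Finset.sum_le_sum fun B hB => ?_
        have hB := (Finset.mem_filter.1 hB).2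
        have huB : u ≤ B.card := by
          have : (u : ℝ) ≤ B.card := by linarith
          exact_mod_cast this
        obtain ⟨j, hj⟩ := Nat.exists_eq_add_of_le huB
        have h1 : (2 ^ d * (9000 * n)) ^ u * s ^ u = (2 ^ d) ^ u := by
          rw [← mul_pow, hs, mul_assoc, mul_inv_cancel₀ (by positivity), mul_one]
        -- Only u of the |B| factors keep their `a`, to be compared with a^u; the others are bounded
        -- by `s`, which is of order 1/n.
        calc (2 ^ d * a) ^ B.card = a ^ u * (2 ^ d) ^ u * (2 ^ d * a) ^ j := by
              rw [hj, pow_add, mul_pow]; ring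
          _ ≤ a ^ u * (2 ^ d) ^ u * s ^ j := by gcongr
          _ = (a ^ u * (2 ^ d * (9000 * n)) ^ u) * s ^ B.card := by
              rw [hj, pow_add, ← h1]; ring
    _ = a ^ u * ((2 ^ d * (9000 * n)) ^ u * ∑ B : Finset V with b < (B.card : ℝ),
          s ^ B.card) := by rw [← Finset.mul_sum, mul_assoc]
    _ ≤ a ^ u * ((2 ^ d * (9000 * n)) ^ u * ((9000 * b) ^ (-b) * Real.exp b)) := by
        gcongr
        refine sum_pow_card_gt_le (by norm_num) (by linarith) hs0.le ?_
        rw [← hn', hs]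
        field_simp
        exact le_rfl
    _ ≤ a ^ u * (1 / 10) := by
        gcongr
        exact two_pow_mul_rpow_neg_le hd hn hb hu hnb
    _ = 1 / 10 * a ^ u := mul_comm _ _

end Tail

/-! ### Weights on a coset of the edge strings -/

section Concentration

set_option linter.unusedSectionVars false

variable {V : Type} [Fintype V] [DecidableEq V] {G : SimpleGraph V} [DecidableRel G.Adj]
variable (num : EdgeNumbering G) {d : ℕ} (hG : G.IsRegularOfDegree d)
  (C : Submodule Bit (Fin d → Bit))

theorem violated_add_of_forall_mem (x k : Qubit G → Bit)
    (hk : ∀ v, localString num hG k v ∈ C) : violated num hG C (x + k) = violated num hG C x := by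
  ext v
  rw [mem_violated, mem_violated, localString_add, C.add_mem_iff_left (hk v)]

open Classical in
-- If two such strings also have the same local strings on `B`, their difference is in `C` at every
-- vertex and so is a Tanner word. On `B` there are 2^d local strings per vertex.
theorem card_violated_eq_le (E₁ : Finset G.edgeSet) (x : Qubit G → Bit) (B : Finset V) :
    (Finset.univ.filter fun y => y ∈ edgeStrings E₁ ∧ violated num hG C (x + y) = B).card ≤
      (Finset.univ.filter fun k => k ∈ tannerCode num hG C E₁).card * (2 ^ d) ^ B.card := by
  set f : (Qubit G → Bit) → (B → Fin d → Bit) := fun y v => localString num hG (x + y) v with hf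
  refine (Finset.card_le_mul_card_image (f := f) _
    (Finset.univ.filter fun k => k ∈ tannerCode num hG C E₁).card ?_).trans ?_
  · intro a ha
    obtain ⟨y₀, hy₀, rfl⟩ := Finset.mem_image.1 ha
    simp only [Finset.mem_filter, Finset.mem_univ, true_and] at hy₀
    refine Finset.card_le_card_of_injOn (fun y => y - y₀) ?_ ?_
    · intro y hy
      simp only [Finset.coe_filter, Finset.mem_filter, Finset.mem_univ, true_and,
        Set.mem_ofPred_eq] at hy ⊢
      refine ⟨sub_mem hy.1.1 hy₀.1, fun v => ?_⟩
      have e : localString num hG (y - y₀) v =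
          localString num hG (x + y) v - localString num hG (x + y₀) v := by
        funext i
        simp [localString]
      rw [e]
      by_cases hv : v ∈ B
      · have := congrFun hy.2 ⟨v, hv⟩
        rw [show localString num hG (x + y) v = localString num hG (x + y₀) v from this, sub_self]
        exact C.zero_mem
      · have h1 : localString num hG (x + y) v ∈ C := by
          by_contra hc
          exact hv (hy.1.2 ▸ (mem_violated num hG C _ v).2 hc)
        have h2 : localString num hG (x + y₀) v ∈ C := by
          by_contra hc
          exact hv (hy₀.2 ▸ (mem_violated num hG C _ v).2 hc)
        exact C.sub_mem h1 h2
    · intro y _ y' _ h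
      exact sub_left_injective h
  · refine Nat.mul_le_mul_left _ ((Finset.card_le_univ _).trans (le_of_eq ?_))
    simp [ZMod.card]

open Classical in
-- The coset contains a string that vanishes on all edges of `E₁`, hence violates only vertices
-- touched by removed edges. Adding Tanner words yields |K| strings with the same violations.
theorem le_sum_pow_violated {E₁ : Finset G.edgeSet} {x : Qubit G → Bit}
    (hx : ∀ e ∈ E₁, EdgeConst x e) {a : ℝ} (ha : 0 < a) (ha1 : a ≤ 1) :
    ((Finset.univ.filter fun k => k ∈ tannerCode num hG C E₁).card : ℝ) *
        a ^ (coveredVertices E₁ᶜ).card ≤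
      ∑ y with y ∈ edgeStrings E₁, a ^ (violated num hG C (x + y)).card := by
  set y₀ : Qubit G → Bit := fun p => if p.1.2 ∈ E₁ then x p else 0 with hy₀
  have hy₀mem : y₀ ∈ edgeStrings E₁ := by
    refine ⟨fun e he p p' hp hp' => ?_, fun p hp => ?_⟩
    · simp only [hy₀, hp, hp', he, if_true]
      exact hx e he p p' hp hp'
    · simp only [hy₀, hp, if_false]
  have hv : violated num hG C (x + y₀) ⊆ coveredVertices E₁ᶜ := by
    intro v hv
    by_contra hc
    rw [mem_violated] at hv
    apply hv
    have : localString num hG (x + y₀) v = 0 := by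
      funext i
      rw [localString_eq, Pi.add_apply, hy₀]
      simp only
      rw [if_pos, bit_add_self]
      · rfl
      · by_contra hc'
        exact hc (Finset.mem_image.2 ⟨qubitEquiv num hG (v, i),
          Finset.mem_filter.2 ⟨Finset.mem_univ _, Finset.mem_compl.2 hc'⟩, rfl⟩)
    rw [this]
    exact C.zero_mem
  rw [← nsmul_eq_mul, ← Finset.sum_const]
  calc ∑ k with k ∈ tannerCode num hG C E₁, a ^ (coveredVertices E₁ᶜ).card
      ≤ ∑ k with k ∈ tannerCode num hG C E₁, a ^ (violated num hG C (x + (y₀ + k))).card := by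
        refine Finset.sum_le_sum fun k hk => ?_
        have hk := (Finset.mem_filter.1 hk).2
        rw [← add_assoc, violated_add_of_forall_mem num hG C _ k hk.2]
        exact pow_le_pow_of_le_one ha.le ha1 (Finset.card_le_card hv)
    _ = ∑ y ∈ (Finset.univ.filter fun k => k ∈ tannerCode num hG C E₁).image (y₀ + ·),
          a ^ (violated num hG C (x + y)).card := by
        rw [Finset.sum_image fun _ _ _ _ h => add_right_injective y₀ h]
    _ ≤ _ := by
        refine Finset.sum_le_sum_of_subset_of_nonneg ?_ fun _ _ _ => by positivity
        intro y hy
        obtain ⟨k, hk, rfl⟩ := Finset.mem_image.1 hy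
        exact Finset.mem_filter.2 ⟨Finset.mem_univ _,
          add_mem hy₀mem (Finset.mem_filter.1 hk).2.1⟩

open Classical in
-- Grouping by the violated set `B` bounds the tail by |K| times the sum of (2^d a)^|B|; the factor
-- |K| cancels against the lower bound for the whole coset.
theorem sum_pow_violated_gt_le {E₁ : Finset G.edgeSet} {x : Qubit G → Bit}
    (hx : ∀ e ∈ E₁, EdgeConst x e) {a b : ℝ} (hd : 0 < d) (hV : 0 < Fintype.card V) (hb : 1 ≤ b)
    (hu : (2 * E₁ᶜ.card : ℝ) ≤ b / (3 * d))
    (hnb : (Fintype.card V : ℝ) ≤ 100 * b * d ^ 2) (ha : 0 < a)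
    (han : 2 ^ d * a * (9000 * Fintype.card V) ≤ 1) :
    ∑ y with y ∈ edgeStrings E₁,
        (if b < ((violated num hG C (x + y)).card : ℝ) then
          a ^ (violated num hG C (x + y)).card else 0) ≤
      1 / 10 * ∑ y with y ∈ edgeStrings E₁, a ^ (violated num hG C (x + y)).card := by
  set K := (Finset.univ.filter fun k => k ∈ tannerCode num hG C E₁).card with hK
  have ha1 : a ≤ 1 := by
    have h1 : (1 : ℝ) ≤ 2 ^ d := one_le_pow₀ (by norm_num)
    have h2 : (1 : ℝ) ≤ Fintype.card V := by exact_mod_cast hV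
    have h3 : (1 : ℝ) ≤ 2 ^ d * (9000 * Fintype.card V) := by nlinarith
    nlinarith
  calc ∑ y with y ∈ edgeStrings E₁, (if b < ((violated num hG C (x + y)).card : ℝ) then
          a ^ (violated num hG C (x + y)).card else 0)
      = ∑ B : Finset V, ∑ y with y ∈ edgeStrings E₁ ∧ violated num hG C (x + y) = B,
          (if b < (B.card : ℝ) then a ^ B.card else 0) := by
        rw [← Finset.sum_fiberwise (Finset.univ.filter fun y => y ∈ edgeStrings E₁)
          fun y => violated num hG C (x + y)]
        refine Finset.sum_congr rfl fun B _ => ?_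
        rw [Finset.filter_filter]
        refine Finset.sum_congr rfl fun y hy => ?_
        rw [(Finset.mem_filter.1 hy).2.2]
    _ ≤ ∑ B : Finset V, if b < (B.card : ℝ) then K * (2 ^ d * a) ^ B.card else 0 := by
        refine Finset.sum_le_sum fun B _ => ?_
        rw [Finset.sum_const, nsmul_eq_mul]
        split_ifs with h
        · have := (Nat.cast_le (α := ℝ)).2 (card_violated_eq_le num hG C E₁ x B)
          push_cast at this
          rw [mul_pow, ← mul_assoc]
          gcongr
        · rw [mul_zero]
    _ = K * ∑ B : Finset V with b < (B.card : ℝ), (2 ^ d * a) ^ B.card := by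
        rw [← Finset.sum_filter, Finset.mul_sum]
    _ ≤ K * (1 / 10 * a ^ (coveredVertices E₁ᶜ).card) := by
        gcongr
        refine sum_two_pow_mul_pow_le hd hV hb (le_trans ?_ hu) hnb ha han
        exact_mod_cast card_coveredVertices_le E₁ᶜ
    _ = 1 / 10 * (K * a ^ (coveredVertices E₁ᶜ).card) := by ring
    _ ≤ _ := by
        gcongr
        exact le_sum_pow_violated num hG C hx ha ha1

end Concentration

/-! ### The measurement statistics of the ground states -/

section Statistics

set_option linter.unusedSectionVars false

variable {V : Type} [Fintype V] [DecidableEq V] {G : SimpleGraph V} [DecidableRel G.Adj]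
variable (num : EdgeNumbering G) {d : ℕ} (hG : G.IsRegularOfDegree d)
  (C : Submodule Bit (Fin d → Bit))

theorem bits_add_self {ι : Type} (x : ι → Bit) : x + x = 0 := funext fun _ => bit_add_self _

theorem bits_add_add_cancel {ι : Type} (x k : ι → Bit) : x + k + k = x := by
  rw [add_assoc, bits_add_self, add_zero]

theorem apply_add_sum_edgeFlip {β : Type} {φ : (Qubit G → Bit) → β} {E₁ : Finset G.edgeSet}
    (hφ : ∀ e ∈ E₁, ∀ x, φ (x + edgeFlip e) = φ x) (S : Finset G.edgeSet) (hS : S ⊆ E₁)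
    (x : Qubit G → Bit) : φ (x + ∑ e ∈ S, edgeFlip e) = φ x := by
  induction S using Finset.induction_on generalizing x with
  | empty => simp
  | insert e S he ih =>
    rw [Finset.sum_insert he, ← add_assoc, ih (fun _ h => hS (Finset.mem_insert_of_mem h)),
      hφ e (hS (Finset.mem_insert_self _ _))]

/-- The flips of the edges in `E₁` span the edge strings, so invariance under single flips becomes
invariance under all of them. -/
theorem exists_eq_sum_edgeFlip {E₁ : Finset G.edgeSet} {y : Qubit G → Bit}
    (hy : y ∈ edgeStrings E₁) : ∃ S ⊆ E₁, y = ∑ e ∈ S, edgeFlip e := by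
  classical
  refine ⟨E₁.filter fun e => ∃ p : Qubit G, p.1.2 = e ∧ y p = 1, Finset.filter_subset _ _, ?_⟩
  funext p
  rw [Finset.sum_apply]
  simp only [edgeFlip, Finset.sum_ite_eq, Finset.mem_filter]
  split_ifs with h
  · obtain ⟨h1, p', hp', h2⟩ := h
    rw [← h2]
    exact hy.1 _ h1 _ _ rfl hp'
  · obtain h0 | h1 := bit_eq_zero_or_one (y p)
    · exact h0
    · exfalso
      apply h
      refine ⟨?_, p, rfl, h1⟩
      by_contra hc
      rw [hy.2 p hc] at h1
      exact zero_ne_one h1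

theorem apply_add_of_mem_edgeStrings {β : Type} {φ : (Qubit G → Bit) → β}
    {E₁ : Finset G.edgeSet} (hφ : ∀ e ∈ E₁, ∀ x, φ (x + edgeFlip e) = φ x) {y : Qubit G → Bit}
    (hy : y ∈ edgeStrings E₁) (x : Qubit G → Bit) : φ (x + y) = φ x := by
  obtain ⟨S, hS, rfl⟩ := exists_eq_sum_edgeFlip hy
  exact apply_add_sum_edgeFlip hφ S hS x

/-- Relative to a string without violations, each violated vertex replaces a factor (1 + δ)² by δ².
-/
theorem totalWeight_sq {δ : ℝ} (h1 : 1 + δ ≠ 0) (z : Qubit G → Bit) :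
    totalWeight num hG C δ z ^ 2 =
      ((1 + δ) ^ 2) ^ Fintype.card V * ((δ / (1 + δ)) ^ 2) ^ (violated num hG C z).card := by
  classical
  have e : ∀ v, vertexWeight num hG C δ z v ^ 2 =
      (1 + δ) ^ 2 * if localString num hG z v ∉ C then (δ / (1 + δ)) ^ 2 else 1 := by
    intro v
    rw [vertexWeight]
    by_cases h : localString num hG z v ∈ C
    · rw [if_pos h, if_neg (not_not.2 h), mul_one]
    · rw [if_neg h, if_pos h, zero_add]
      field_simp
  rw [totalWeight, ← Finset.prod_pow, Finset.prod_congr rfl fun v _ => e v,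
    Finset.prod_mul_distrib, Finset.prod_const, Finset.card_univ, ← Finset.prod_filter,
    Finset.prod_const]
  rfl

open Classical in
/-- A weighted distribution that is invariant under the edge strings rarely has more than `b`
violated vertices. -/
theorem sum_violated_gt_le {E₁ : Finset G.edgeSet} {μ p : (Qubit G → Bit) → ℝ} {a b c : ℝ}
    (hc : 0 ≤ c) (hp : ∀ x, p x = c * a ^ (violated num hG C x).card * μ x)
    (hμ0 : ∀ x, 0 ≤ μ x) (hμE : ∀ x, ∀ e ∈ E₁, ¬ EdgeConst x e → μ x = 0)
    (hμ : ∀ y ∈ edgeStrings E₁, ∀ x, μ (x + y) = μ x) (hd : 0 < d) (hV : 0 < Fintype.card V)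
    (hb : 1 ≤ b) (hu : (2 * E₁ᶜ.card : ℝ) ≤ b / (3 * d))
    (hnb : (Fintype.card V : ℝ) ≤ 100 * b * d ^ 2) (ha : 0 < a)
    (han : 2 ^ d * a * (9000 * Fintype.card V) ≤ 1) :
    ∑ x, (if b < ((violated num hG C x).card : ℝ) then p x else 0) ≤ 1 / 10 * ∑ x, p x := by
  set L := Finset.univ.filter fun y => y ∈ edgeStrings E₁ with hL
  have hLpos : (0 : ℝ) < L.card := by
    have : 0 < L.card := Finset.card_pos.2 ⟨0, by simp [hL]⟩
    exact_mod_cast this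
  -- Averaging over translations by edge strings reduces the claim to a single coset, on which μ is
  -- constant.
  have havg : ∀ g : (Qubit G → Bit) → ℝ, L.card * ∑ x, g x = ∑ x, ∑ y ∈ L, g (x + y) := by
    intro g
    rw [Finset.sum_comm, ← nsmul_eq_mul, ← Finset.sum_const]
    exact Finset.sum_congr rfl fun y _ => (Equiv.sum_comp (Equiv.addRight y) g).symm
  refine le_of_mul_le_mul_left ?_ hLpos
  rw [mul_left_comm, havg, havg, Finset.mul_sum]
  refine Finset.sum_le_sum fun x _ => ?_
  by_cases hx : ∀ e ∈ E₁, EdgeConst x e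
  · have h1 := sum_pow_violated_gt_le num hG C hx hd hV hb hu hnb ha han
    have e1 : ∑ y ∈ L, (if b < ((violated num hG C (x + y)).card : ℝ) then p (x + y) else 0) =
        c * μ x * ∑ y ∈ L, (if b < ((violated num hG C (x + y)).card : ℝ) then
          a ^ (violated num hG C (x + y)).card else 0) := by
      rw [Finset.mul_sum]
      refine Finset.sum_congr rfl fun y hy => ?_
      rw [hp, hμ y (Finset.mem_filter.1 hy).2]
      split_ifs <;> ring
    have e2 : ∑ y ∈ L, p (x + y) =
        c * μ x * ∑ y ∈ L, a ^ (violated num hG C (x + y)).card := by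
      rw [Finset.mul_sum]
      refine Finset.sum_congr rfl fun y hy => ?_
      rw [hp, hμ y (Finset.mem_filter.1 hy).2]
      ring
    rw [e1, e2, mul_left_comm]
    exact mul_le_mul_of_nonneg_left h1 (mul_nonneg hc (hμ0 x))
  · push Not at hx
    obtain ⟨e, he, hxe⟩ := hx
    have h0 : ∀ y ∈ L, p (x + y) = 0 := fun y hy => by
      rw [hp, hμ y (Finset.mem_filter.1 hy).2, hμE x e he hxe, mul_zero]
    rw [Finset.sum_eq_zero fun y hy => by rw [h0 y hy, ite_self],
      Finset.sum_eq_zero h0, mul_zero]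

end Statistics

/-! ### Clusters of approximate codewords -/

section Clusters

/-- If a translation `x ↦ x + k` moves every class of an equivalence relation on `S` to another
class, then `S` is the disjoint union of a set of classes and its translate. -/
theorem exists_halving {X : Type} [Fintype X] [DecidableEq X] [AddCommGroup X] (S : Finset X)
    (R : X → X → Prop) (k : X) (hk : ∀ x, x + k + k = x) (hS : ∀ x ∈ S, x + k ∈ S)
    (hrefl : ∀ x ∈ S, R x x) (hsymm : ∀ x y, R x y → R y x)
    (htrans : ∀ x ∈ S, ∀ y ∈ S, ∀ z ∈ S, R x y → R y z → R x z)
    (hRk : ∀ x y, R x y → R (x + k) (y + k)) (hne : ∀ x ∈ S, ¬ R x (x + k))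
    {p : X → ℝ} (hp : ∀ x, p (x + k) = p x) :
    ∃ A ⊆ S, ∃ A' ⊆ S, (∀ x ∈ A, ∀ y ∈ A', ¬ R x y) ∧
      ∑ x ∈ A, p x = (∑ x ∈ S, p x) / 2 ∧ ∑ x ∈ A', p x = (∑ x ∈ S, p x) / 2 := by
  classical
  set cl : X → Finset X := fun x => S.filter fun y => R x y with hcl
  -- An arbitrary numbering of the classes. It decides which of a class and its translate goes into
  -- `A`, so that `A` and its complement in `S` are unions of classes exchanged by the translation.
  set code : X → Fin (Fintype.card (Finset X)) := fun x => Fintype.equivFin _ (cl x) with hcode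
  have hcode_ne : ∀ x ∈ S, code x ≠ code (x + k) := by
    intro x hx h
    have h1 : cl x = cl (x + k) := (Fintype.equivFin _).injective h
    have h2 : x + k ∈ cl x := by
      rw [h1]
      exact Finset.mem_filter.2 ⟨hS x hx, hrefl _ (hS x hx)⟩
    exact hne x hx (Finset.mem_filter.1 h2).2
  have hcode_eq : ∀ x ∈ S, ∀ y ∈ S, R x y → code x = code y := by
    intro x hx y hy h
    have : cl x = cl y := by
      ext z
      simp only [hcl, Finset.mem_filter]
      exact and_congr_right fun hz => ⟨fun h' => htrans y hy x hx z hz (hsymm _ _ h) h',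
        fun h' => htrans x hx y hy z hz h h'⟩
    simp only [hcode, this]
  set A := S.filter fun x => code x < code (x + k) with hA
  set A' := S.filter fun x => ¬ code x < code (x + k) with hA'
  have hsum : ∑ x ∈ A, p x = ∑ x ∈ A', p x := by
    refine Finset.sum_bij (fun x _ => x + k) ?_ ?_ ?_ ?_
    · intro x hx
      rw [hA, Finset.mem_filter] at hx
      rw [hA', Finset.mem_filter, hk]
      exact ⟨hS x hx.1, not_lt.2 hx.2.le⟩
    · intro x _ y _ h
      exact add_right_cancel h
    · intro x hx
      rw [hA', Finset.mem_filter] at hx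
      refine ⟨x + k, ?_, hk x⟩
      rw [hA, Finset.mem_filter, hk]
      exact ⟨hS x hx.1, lt_of_le_of_ne (not_lt.1 hx.2) (hcode_ne x hx.1).symm⟩
    · intro x _
      exact (hp x).symm
  have htot : ∑ x ∈ A, p x + ∑ x ∈ A', p x = ∑ x ∈ S, p x :=
    Finset.sum_filter_add_sum_filter_not _ _ _
  refine ⟨A, Finset.filter_subset _ _, A', Finset.filter_subset _ _, ?_, by linarith,
    by linarith⟩
  intro x hx y hy h
  rw [hA, Finset.mem_filter] at hx
  rw [hA', Finset.mem_filter] at hy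
  apply hy.2
  rw [← hcode_eq x hx.1 y hy.1 h,
    ← hcode_eq _ (hS x hx.1) _ (hS y hy.1) (hRk x y h)]
  exact hx.2

/-- The gap in the number of active vertices. -/
theorem active_gap {D d n l t β r : ℝ} (hD : 0 < D) (hd : 1 ≤ d) (hDd : D ≤ d) (hn : 0 < n)
    (ht : 0 ≤ t) (hl : 4 * l ≤ D) (hβ : β ≤ n * D ^ 2 / (50 * d ^ 2))
    (hr : r ≤ n * D ^ 2 / (300 * d ^ 3)) (h : D * (t - β) ≤ d * t ^ 2 / n + l * t + r) :
    t ≤ 0.05 * (n * D / d) ∨ 0.7 * (n * D / d) ≤ t := by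
  have hd0 : 0 < d := by linarith
  set w := n * D / d with hw
  have hw0 : 0 < w := by positivity
  -- In units of w = nD/d the quadratic term is y² and the left-hand term Dt is y, both times Dw.
  obtain ⟨y, rfl⟩ : ∃ y, t = y * w := ⟨t / w, by field_simp⟩
  have hy : 0 ≤ y := nonneg_of_mul_nonneg_left ht hw0
  have h1 : d * (y * w) ^ 2 / n = y ^ 2 * (D * w) := by rw [hw]; field_simp
  have h2 : D * β ≤ 1 / 50 * (D * w) := by
    calc D * β ≤ D * (n * D ^ 2 / (50 * d ^ 2)) := by gcongr
      _ = 1 / 50 * (D * w) * (D / d) := by rw [hw]; field_simp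
      _ ≤ 1 / 50 * (D * w) * 1 := by gcongr; rwa [div_le_one hd0]
      _ = _ := mul_one _
  have h3 : r ≤ 1 / 300 * (D * w) := by
    calc r ≤ n * D ^ 2 / (300 * d ^ 3) := hr
      _ = 1 / 300 * (D * w) * (1 / d ^ 2) := by rw [hw]; field_simp
      _ ≤ 1 / 300 * (D * w) * 1 := by
          gcongr
          rw [div_le_one (by positivity)]
          nlinarith
      _ = _ := mul_one _
  have h4 : l * (y * w) ≤ 1 / 4 * y * (D * w) := by nlinarith [mul_nonneg hy hw0.le]
  have h5 : (D * w) * (3 / 4 * y) ≤ (D * w) * (y ^ 2 + 1 / 50 + 1 / 300) := by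
    rw [h1] at h
    nlinarith
  -- The inequality y² - (3/4)y + 7/300 ≥ 0 has roots near 0.033 and 0.717, so it fails strictly
  -- between 0.05 and 0.7.
  have h6 := le_of_mul_le_mul_left h5 (by positivity)
  by_cases hy5 : y ≤ 0.05
  · left; gcongr
  · right
    have : 0.7 ≤ y := by
      by_contra hc
      push Not at hc hy5
      nlinarith [mul_pos (sub_pos.2 hc) (sub_pos.2 hy5)]
    gcongr

/-- A lower bound on the variance of a function that separates two sets. -/
theorem variance_ge_of_separated {X : Type} [Fintype X] [DecidableEq X] (r f : X → ℝ)
    (hr : ∀ x, 0 ≤ r x) (hr1 : ∑ x, r x = 1) {S S' : Finset X} {D : ℝ} (hD : 0 < D)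
    (hf0 : ∀ x, 0 ≤ f x) (hS : ∀ x ∈ S, f x = 0) (hS' : ∀ x ∈ S', D ≤ f x)
    (hrS : 0.35 ≤ ∑ x ∈ S, r x) (hrS' : 0.35 ≤ ∑ x ∈ S', r x) :
    0.175 * D ^ 2 ≤ ∑ x, f x ^ 2 * r x - (∑ x, f x * r x) ^ 2 := by
  set m := ∑ x, f x * r x with hm
  have hm0 : 0 ≤ m := Finset.sum_nonneg fun x _ => mul_nonneg (hf0 x) (hr x)
  have hvar : ∑ x, f x ^ 2 * r x - m ^ 2 = ∑ x, (f x - m) ^ 2 * r x := by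
    have e : ∀ x, (f x - m) ^ 2 * r x = f x ^ 2 * r x - 2 * m * (f x * r x) + m ^ 2 * r x :=
      fun x => by ring
    rw [Finset.sum_congr rfl fun x _ => e x, Finset.sum_add_distrib, Finset.sum_sub_distrib,
      ← Finset.mul_sum, ← Finset.mul_sum, ← hm, hr1]
    ring
  -- Truncated because the mean may exceed `D`. In any case m + g ≥ D, so m² + g² ≥ D²/2, and 0.35/2
  -- = 0.175.
  set g := max (D - m) 0 with hg
  have hg0 : 0 ≤ g := le_max_right _ _
  have hdisj : Disjoint S S' := by
    rw [Finset.disjoint_left]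
    intro x hx hx'
    have := hS' x hx'
    rw [hS x hx] at this
    linarith
  have h1 : ∑ x ∈ S, m ^ 2 * r x + ∑ x ∈ S', g ^ 2 * r x ≤ ∑ x, (f x - m) ^ 2 * r x := by
    calc ∑ x ∈ S, m ^ 2 * r x + ∑ x ∈ S', g ^ 2 * r x
        ≤ ∑ x ∈ S, (f x - m) ^ 2 * r x + ∑ x ∈ S', (f x - m) ^ 2 * r x := by
          refine add_le_add (Finset.sum_le_sum fun x hx => ?_)
            (Finset.sum_le_sum fun x hx => ?_)
          · rw [hS x hx, zero_sub, neg_sq]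
          · refine mul_le_mul_of_nonneg_right ?_ (hr x)
            rw [sq_le_sq, abs_of_nonneg hg0, hg]
            refine max_le ?_ (abs_nonneg _)
            exact (by linarith [hS' x hx] : D - m ≤ f x - m).trans (le_abs_self _)
      _ = ∑ x ∈ S ∪ S', (f x - m) ^ 2 * r x := (Finset.sum_union hdisj).symm
      _ ≤ _ := Finset.sum_le_sum_of_subset_of_nonneg (Finset.subset_univ _)
          fun x _ _ => mul_nonneg (sq_nonneg _) (hr x)
  rw [← Finset.mul_sum, ← Finset.mul_sum] at h1
  rw [hvar]
  have h2 : m ^ 2 * 0.35 ≤ m ^ 2 * ∑ x ∈ S, r x := by gcongr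
  have h3 : g ^ 2 * 0.35 ≤ g ^ 2 * ∑ x ∈ S', r x := by gcongr
  have h4 : D ^ 2 ≤ 2 * (m ^ 2 + g ^ 2) := by
    have : D ≤ m + g := by linarith [le_max_left (D - m) 0]
    nlinarith [sq_nonneg (m - g)]
  linarith

/-- The Hamming distance to a nonempty set. -/
noncomputable def distTo {ι : Type} [Fintype ι] (A : Finset (ι → Bit)) (hA : A.Nonempty)
    (x : ι → Bit) : ℝ :=
  A.inf' hA fun z => (hammingDist x z : ℝ)

theorem distTo_le_add {ι : Type} [Fintype ι] (A : Finset (ι → Bit)) (hA : A.Nonempty)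
    (x y : ι → Bit) : distTo A hA x ≤ distTo A hA y + hammingDist x y := by
  obtain ⟨z, hz, h⟩ := A.exists_mem_eq_inf' hA fun z => (hammingDist y z : ℝ)
  rw [distTo, distTo, h]
  refine (Finset.inf'_le _ hz).trans ?_
  rw [add_comm]
  exact_mod_cast hammingDist_triangle x y z

theorem abs_distTo_sub_le {ι : Type} [Fintype ι] (A : Finset (ι → Bit)) (hA : A.Nonempty)
    (x y : ι → Bit) : |distTo A hA x - distTo A hA y| ≤ hammingDist x y := by
  rw [abs_sub_le_iff]
  have h1 := distTo_le_add A hA x y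
  have h2 := distTo_le_add A hA y x
  rw [hammingDist_comm y x] at h2
  constructor <;> linarith

theorem distTo_nonneg {ι : Type} [Fintype ι] (A : Finset (ι → Bit)) (hA : A.Nonempty)
    (x : ι → Bit) : 0 ≤ distTo A hA x :=
  Finset.le_inf' hA _ fun _ _ => Nat.cast_nonneg _

theorem distTo_of_mem {ι : Type} [Fintype ι] {A : Finset (ι → Bit)} (hA : A.Nonempty)
    {x : ι → Bit} (hx : x ∈ A) : distTo A hA x = 0 := by
  refine le_antisymm ((Finset.inf'_le _ hx).trans ?_) (distTo_nonneg A hA x)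
  rw [hammingDist_self, Nat.cast_zero]

end Clusters

/-! ### Depth lower bounds from separated sets of outcomes -/

section Depth

variable {Q A : Type} [Fintype Q] [DecidableEq Q] [Fintype A] [DecidableEq A]

theorem sum_lift_eq (F : (Q ⊕ A → Bit) → ℝ) (S : Finset (Q → Bit)) :
    ∑ x with (fun q => x (Sum.inl q)) ∈ S, F x = ∑ z ∈ S, ∑ w : A → Bit, F (Sum.elim z w) := by
  rw [← Finset.sum_product']
  symm
  refine Finset.sum_bij (fun p _ => Sum.elim p.1 p.2) ?_ ?_ ?_ ?_
  · intro p hp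
    simpa using hp
  · rintro ⟨z, w⟩ _ ⟨z', w'⟩ _ h
    refine Prod.ext ?_ ?_
    · funext q; exact congrFun h (Sum.inl q)
    · funext q; exact congrFun h (Sum.inr q)
  · intro x hx
    exact ⟨(fun q => x (Sum.inl q), fun q => x (Sum.inr q)), by simpa using hx,
      Sum.elim_comp_inl_inr x⟩
  · intro _ _
    rfl

theorem sum_sum_elim_eq_normSq (Γ : (Q ⊕ A → Bit) → ℂ) :
    ∑ z : Q → Bit, ∑ w : A → Bit, ‖Γ (Sum.elim z w)‖ ^ 2 = normSq Γ := by
  rw [← sum_lift_eq (fun x => ‖Γ x‖ ^ 2) Finset.univ, normSq]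
  congr 1
  ext x
  simp

/-- If the outcomes of a measurement of a state on the qubits in `Q` fall into two distant sets
with large probability, then circuits that prepare nearby states are deep. -/
theorem sq_le_card_mul_of_separated (U : Circuit (Q ⊕ A)) {Γ : (Q ⊕ A → Bit) → ℂ}
    (hΓ : normSq Γ = 1) (hdist : traceDist Γ (Circuit.output U) ≤ 0.1)
    {S S' : Finset (Q → Bit)} {D : ℝ} (hD : 0 < D)
    (hsep : ∀ x ∈ S, ∀ y ∈ S', D ≤ hammingDist y x)
    (hS : 0.45 ≤ ∑ z ∈ S, ∑ w : A → Bit, ‖Γ (Sum.elim z w)‖ ^ 2)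
    (hS' : 0.45 ≤ ∑ z ∈ S', ∑ w : A → Bit, ‖Γ (Sum.elim z w)‖ ^ 2) :
    0.175 * D ^ 2 ≤ Fintype.card Q * 8 ^ Circuit.depth U := by
  classical
  have hne : S.Nonempty := by
    rw [Finset.nonempty_iff_ne_empty]
    rintro rfl
    norm_num at hS
  have hψ1 : normSq (Circuit.output U) = 1 := normSq_circuit_output U
  -- Trace distance 0.1 lowers a probability of 0.45 to no less than 0.35.
  have hlow : ∀ T : Finset (Q → Bit), 0.45 ≤ ∑ z ∈ T, ∑ w : A → Bit, ‖Γ (Sum.elim z w)‖ ^ 2 →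
      0.35 ≤ ∑ x with (fun q => x (Sum.inl q)) ∈ T, ‖Circuit.output U x‖ ^ 2 := by
    intro T hT
    have h := abs_sum_sub_sum_le_traceDist Γ (Circuit.output U) (hΓ.trans hψ1.symm)
      (Finset.univ.filter fun x => (fun q => x (Sum.inl q)) ∈ T)
    rw [← sum_lift_eq fun x => ‖Γ x‖ ^ 2] at hT
    have := (le_abs_self _).trans (h.trans hdist)
    norm_num at hT this ⊢
    linarith
  have hvar := variance_ge_of_separated (fun x => ‖Circuit.output U x‖ ^ 2)
    (fun x => distTo S hne fun q => x (Sum.inl q)) (fun _ => by positivity) hψ1 hD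
    (fun _ => distTo_nonneg _ _ _)
    (fun x hx => distTo_of_mem hne (Finset.mem_filter.1 hx).2)
    (S' := Finset.univ.filter fun x => (fun q => x (Sum.inl q)) ∈ S')
    (fun x hx => Finset.le_inf' hne _ fun z hz => hsep z hz _ (Finset.mem_filter.1 hx).2)
    (hlow S hS) (hlow S' hS')
  refine hvar.trans ?_
  -- The function depends only on the qubits in `Q`, so the number of ancillas does not enter the
  -- bound.
  have := variance_circuit_output_le U (Finset.univ.map ⟨Sum.inl, Sum.inl_injective⟩)
    (fun x => distTo S hne fun q => x (Sum.inl q)) (fun x y => by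
      refine (abs_distTo_sub_le S hne _ _).trans (le_of_eq ?_)
      rw [Finset.filter_map, Finset.card_map]
      rfl)
  rwa [Finset.card_map, Finset.card_univ] at this

end Depth

/-! ### The depth lower bound -/

section Main

variable {V : Type} [Fintype V] [DecidableEq V] {G : SimpleGraph V} [DecidableRel G.Adj]

/-- The triangle inequality behind the clustering: in characteristic 2, x + z = (x + y) + (y + z).
-/
theorem activeVertices_add_subset (num : EdgeNumbering G) {d : ℕ} (hG : G.IsRegularOfDegree d)
    (x y z : Qubit G → Bit) :
    activeVertices num hG (x + z) ⊆
      activeVertices num hG (x + y) ∪ activeVertices num hG (y + z) := by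
  intro v hv
  rw [Finset.mem_union, mem_activeVertices, mem_activeVertices]
  rw [mem_activeVertices] at hv
  by_contra! h
  apply hv
  have e : x + z = (x + y) + (y + z) := by
    rw [← add_assoc, bits_add_add_cancel]
  rw [e, localString_add, h.1, h.2, add_zero]

theorem violated_add_subset (num : EdgeNumbering G) {d : ℕ} (hG : G.IsRegularOfDegree d)
    (C : Submodule Bit (Fin d → Bit)) (x y : Qubit G → Bit) :
    violated num hG C (x + y) ⊆ violated num hG C x ∪ violated num hG C y := by
  intro v hv
  rw [Finset.mem_union, mem_violated, mem_violated]
  rw [mem_violated] at hv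
  by_contra! h
  exact hv (C.add_mem h.1 h.2)

theorem activeVertices_zero (num : EdgeNumbering G) {d : ℕ} (hG : G.IsRegularOfDegree d) :
    activeVertices num hG (0 : Qubit G → Bit) = ∅ := by
  ext v
  rw [mem_activeVertices]
  simp only [Finset.notMem_empty, iff_false, not_not]
  rfl

/-- Two far apart sets of approximate codewords, each of which has almost half of the weight of a
distribution that is invariant under the Tanner code. -/
theorem exists_separated_sets (num : EdgeNumbering G) {d : ℕ} (hG : G.IsRegularOfDegree d)
    {C : Submodule Bit (Fin d → Bit)} (hd : 0 < d) (hV : 2 ≤ Fintype.card V) (hC : C ≠ ⊥)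
    (hl : 4 * secondEigenvalue G ≤ codeDist C) {E₁ : Finset G.edgeSet}
    (hE : (2 * E₁ᶜ.card : ℝ) ≤
      Fintype.card V * (codeDist C : ℝ) ^ 2 / (300 * (d : ℝ) ^ 3))
    {k : Qubit G → Bit} (hk : k ∈ tannerCode num hG C E₁) (hk0 : k ≠ 0)
    {p : (Qubit G → Bit) → ℝ} (hpk : ∀ x, p (x + k) = p x)
    (hpE : ∀ x, ∀ e ∈ E₁, ¬ EdgeConst x e → p x = 0) (hp1 : ∑ x, p x = 1)
    (hpb : ∑ x, (if Fintype.card V * (codeDist C : ℝ) ^ 2 / (100 * (d : ℝ) ^ 2) <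
      ((violated num hG C x).card : ℝ) then p x else 0) ≤ 1 / 10) :
    ∃ A A' : Finset (Qubit G → Bit),
      (∀ x ∈ A, ∀ y ∈ A',
        0.68 * (Fintype.card V * (codeDist C : ℝ) ^ 2 / d) ≤ hammingDist y x) ∧
      0.45 ≤ ∑ x ∈ A, p x ∧ 0.45 ≤ ∑ x ∈ A', p x := by
  classical
  have hn0 : (0 : ℝ) < Fintype.card V := by
    have : 0 < Fintype.card V := by omega
    exact_mod_cast this
  have hd1 : (1 : ℝ) ≤ d := by exact_mod_cast hd
  have hd0 : (0 : ℝ) < d := by linarith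
  have hD0 : (0 : ℝ) < codeDist C := by exact_mod_cast codeDist_pos hC
  have hDd : (codeDist C : ℝ) ≤ d := by exact_mod_cast codeDist_le hC
  set n : ℝ := (Fintype.card V : ℝ) with hn
  set D : ℝ := (codeDist C : ℝ) with hDdef
  set b : ℝ := n * D ^ 2 / (100 * (d : ℝ) ^ 2) with hb
  set w : ℝ := n * D / d with hw
  have hw0 : 0 < w := by positivity
  have hb0 : 0 < b := by positivity
  have h2b : 2 * b = n * D ^ 2 / (50 * (d : ℝ) ^ 2) := by rw [hb]; field_simp; norm_num
  -- The threshold is 2b because the dichotomy is applied to sums of two members of `S`.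
  have hquad : ∀ z : Qubit G → Bit, (∀ e ∈ E₁, EdgeConst z e) →
      ((violated num hG C z).card : ℝ) ≤ 2 * b →
      ((activeVertices num hG z).card : ℝ) ≤ 0.05 * w ∨
        0.7 * w ≤ ((activeVertices num hG z).card : ℝ) := by
    intro z hz hv
    exact active_gap hD0 hd1 hDd hn0 (Nat.cast_nonneg _) hl (h2b ▸ hv) hE
      (card_activeVertices_quadratic num hG C hV hz)
  set S : Finset (Qubit G → Bit) := Finset.univ.filter fun x =>
    (∀ e ∈ E₁, EdgeConst x e) ∧ ((violated num hG C x).card : ℝ) ≤ b with hS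
  have hmem : ∀ x, x ∈ S ↔ (∀ e ∈ E₁, EdgeConst x e) ∧
      ((violated num hG C x).card : ℝ) ≤ b := fun x => by simp [hS]
  set R : (Qubit G → Bit) → (Qubit G → Bit) → Prop := fun x y =>
    ((activeVertices num hG (x + y)).card : ℝ) ≤ 0.05 * w with hR
  have hpair : ∀ x ∈ S, ∀ y ∈ S, (∀ e ∈ E₁, EdgeConst (x + y) e) ∧
      ((violated num hG C (x + y)).card : ℝ) ≤ 2 * b := by
    intro x hx y hy
    rw [hmem] at hx hy
    refine ⟨fun e he => (hx.1 e he).add (hy.1 e he), ?_⟩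
    have h1 := (Finset.card_le_card (violated_add_subset num hG C x y)).trans
      (Finset.card_union_le _ _)
    have h2 : ((violated num hG C (x + y)).card : ℝ) ≤
        (violated num hG C x).card + (violated num hG C y).card := by exact_mod_cast h1
    linarith [hx.2, hy.2]
  have hkS : ∀ x ∈ S, x + k ∈ S := by
    intro x hx
    rw [hmem] at hx ⊢
    refine ⟨fun e he => (hx.1 e he).add (hk.1.1 e he), ?_⟩
    rw [violated_add_of_forall_mem num hG C x k hk.2]
    exact hx.2
  -- The word `k` vanishes on the removed edges and has no violations, so the quadratic inequality
  -- holds with all edges kept and no constant term. Dividing by t > 0 excludes small t, which the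
  -- dichotomy alone would allow.
  have hkfar : ¬ ((activeVertices num hG k).card : ℝ) ≤ 0.05 * w := by
    intro hle
    have hv0 : violated num hG C k = ∅ := by
      ext v
      rw [mem_violated]
      simp [hk.2 v]
    have hk' : (0 : ℝ) < (activeVertices num hG k).card := by
      have : 0 < (activeVertices num hG k).card := by
        obtain ⟨q, hq⟩ := Function.ne_iff.1 hk0
        exact Finset.card_pos.2 ⟨_, mem_activeVertices_of_ne_zero num hG k q hq⟩
      exact_mod_cast this
    have hkE : ∀ e ∈ (Finset.univ : Finset G.edgeSet), EdgeConst k e := by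
      intro e _
      by_cases he : e ∈ E₁
      · exact hk.1.1 e he
      · intro q q' hq hq'
        rw [hk.1.2 q (hq.symm ▸ he), hk.1.2 q' (hq'.symm ▸ he)]
    have h1 := card_activeVertices_quadratic num hG C hV hkE
    rw [hv0, Finset.compl_univ, Finset.card_empty, Finset.card_empty, Nat.cast_zero, mul_zero,
      sub_zero, add_zero, ← hn, ← hDdef] at h1
    set t : ℝ := ((activeVertices num hG k).card : ℝ) with ht
    have h2 : (d : ℝ) * t ^ 2 / n = t * (d * t / n) := by ring
    have h3 : (d : ℝ) * t / n ≤ 0.05 * D := by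
      calc (d : ℝ) * t / n ≤ d * (0.05 * w) / n := by gcongr
        _ = 0.05 * D := by rw [hw]; field_simp
    have h4 : t * D ≤ t * (0.05 * D + D / 4) := by
      calc t * D = D * t := mul_comm _ _
        _ ≤ t * (d * t / n) + secondEigenvalue G * t := h2 ▸ h1
        _ = t * (d * t / n + secondEigenvalue G) := by ring
        _ ≤ t * (0.05 * D + D / 4) := by
            gcongr
            linarith
    have h5 := le_of_mul_le_mul_left h4 hk'
    linarith
  obtain ⟨A, hA, A', hA', hsep, hsumA, hsumA'⟩ := exists_halving S R k
    (fun x => bits_add_add_cancel x k) hkS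
    (fun x _ => by simp only [hR, bits_add_self, activeVertices_zero]; simp; positivity)
    (fun x y h => by simpa only [hR, add_comm y x] using h)
    -- Two close pairs give at most 0.1 w active vertices, which is below 0.7 w, so the gap forces
    -- at most 0.05 w.
    (fun x hx y hy z hz h1 h2 => by
      have h3 := (Finset.card_le_card (activeVertices_add_subset num hG x y z)).trans
        (Finset.card_union_le _ _)
      have h4 : ((activeVertices num hG (x + z)).card : ℝ) ≤
          (activeVertices num hG (x + y)).card + (activeVertices num hG (y + z)).card := by
        exact_mod_cast h3
      simp only [hR] at h1 h2 ⊢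
      obtain h5 | h5 := hquad _ (hpair x hx z hz).1 (hpair x hx z hz).2
      · exact h5
      · linarith)
    (fun x y h => by
      have : x + k + (y + k) = x + y := by
        rw [add_add_add_comm, bits_add_self, add_zero]
      simpa only [hR, this] using h)
    (fun x _ h => hkfar (by
      have : x + (x + k) = k := by rw [← add_assoc, bits_add_self, zero_add]
      simpa only [hR, this] using h))
    hpk
  have hpS : 0.9 ≤ ∑ x ∈ S, p x := by
    have h1 : ∑ x, p x = ∑ x ∈ S, p x +
        ∑ x, (if b < ((violated num hG C x).card : ℝ) then p x else 0) := by
      rw [hS, Finset.sum_filter, ← Finset.sum_add_distrib]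
      refine Finset.sum_congr rfl fun x _ => ?_
      by_cases hx : ∀ e ∈ E₁, EdgeConst x e
      · by_cases hx' : ((violated num hG C x).card : ℝ) ≤ b
        · rw [if_pos ⟨hx, hx'⟩, if_neg (not_lt.2 hx'), add_zero]
        · rw [if_neg fun h => hx' h.2, if_pos (not_le.1 hx'), zero_add]
      · have hx0 : p x = 0 := by
          push Not at hx
          obtain ⟨e, he, hxe⟩ := hx
          exact hpE x e he hxe
        rw [hx0, ite_self, ite_self, add_zero]
    rw [hp1] at h1
    linarith
  refine ⟨A, A', ?_, by rw [hsumA]; linarith, by rw [hsumA']; linarith⟩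
  intro x hx y hy
  have hnR := hsep x hx y hy
  obtain ⟨hc, hv⟩ := hpair y (hA' hy) x (hA hx)
  have hfar : 0.7 * w ≤ ((activeVertices num hG (y + x)).card : ℝ) :=
    (hquad _ hc hv).resolve_left fun h => hnR (by simpa only [hR, add_comm x y] using h)
  have h1 := codeDist_mul_le_card_ne_zero num hG C (y + x)
  have h2 : (Finset.univ.filter fun q => (y + x) q ≠ 0).card = hammingDist y x := by
    rw [hammingDist]
    congr 1
    ext q
    have : (y + x) q ≠ 0 ↔ y q ≠ x q := by
      rw [Pi.add_apply, not_iff_not]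
      generalize y q = s
      generalize x q = t
      revert s t
      decide
    simp only [Finset.mem_filter, this]
  rw [h2] at h1
  have h3 : D * (((activeVertices num hG (y + x)).card : ℝ) -
      (violated num hG C (y + x)).card) ≤ hammingDist y x := by
    refine le_trans ?_ ((Nat.cast_le (α := ℝ)).2 h1)
    rw [Nat.cast_mul]
    gcongr
    have : (activeVertices num hG (y + x)).card ≤ (activeVertices num hG (y + x)).card -
        (violated num hG C (y + x)).card + (violated num hG C (y + x)).card := by omega
    have := (Nat.cast_le (α := ℝ)).2 this
    rw [Nat.cast_add] at this
    linarith
  have h4 : 2 * b ≤ 0.02 * w := by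
    rw [h2b]
    calc n * D ^ 2 / (50 * (d : ℝ) ^ 2) = 0.02 * w * (D / d) := by rw [hw]; field_simp; norm_num
      _ ≤ 0.02 * w * 1 := by gcongr; rwa [div_le_one hd0]
      _ = 0.02 * w := mul_one _
  calc 0.68 * (n * D ^ 2 / d) = D * (0.7 * w - 0.02 * w) := by rw [hw]; field_simp; norm_num
    _ ≤ D * (((activeVertices num hG (y + x)).card : ℝ) -
      (violated num hG C (y + x)).card) := by
        gcongr
        linarith
    _ ≤ _ := h3

/-- The distribution of the measurement outcomes of a ground state. -/
theorem IsGroundState.exists_weight (num : EdgeNumbering G) {d : ℕ} (hG : G.IsRegularOfDegree d)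
    (C : Submodule Bit (Fin d → Bit)) {δ : ℝ} (h0 : δ ≠ 0) (h1 : 1 + δ ≠ 0)
    {E₁ : Finset G.edgeSet} {A : Type} [Fintype A] [DecidableEq A] {Γ : (Qubit G ⊕ A → Bit) → ℂ}
    (hΓ : IsGroundState (hamiltonian num hG C δ E₁) Γ) :
    ∃ μ : (Qubit G → Bit) → ℝ,
      (∀ x, ∑ w : A → Bit, ‖Γ (Sum.elim x w)‖ ^ 2 = ((1 + δ) ^ 2) ^ Fintype.card V *
        ((δ / (1 + δ)) ^ 2) ^ (violated num hG C x).card * μ x) ∧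
      (∀ x, 0 ≤ μ x) ∧ (∀ x, ∀ e ∈ E₁, ¬ EdgeConst x e → μ x = 0) ∧
      ∀ y ∈ edgeStrings E₁, ∀ x, μ (x + y) = μ x := by
  obtain ⟨φ, hφ, hφE, hφinv⟩ := hΓ.exists_amplitude num hG C h0 h1
  refine ⟨fun x => ∑ w, ‖φ w x‖ ^ 2, fun x => ?_,
    fun x => Finset.sum_nonneg fun _ _ => by positivity, fun x e he hxe => ?_, fun y hy x => ?_⟩
  · rw [← totalWeight_sq num hG C h1, Finset.mul_sum]
    refine Finset.sum_congr rfl fun w _ => ?_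
    rw [hφ, norm_mul, mul_pow, Complex.norm_real, Real.norm_eq_abs, sq_abs]
  · exact Finset.sum_eq_zero fun w _ => by rw [hφE w e he x hxe, norm_zero, zero_pow two_ne_zero]
  · exact Finset.sum_congr rfl fun w _ => by rw [apply_add_of_mem_edgeStrings (hφinv w) hy]

/-- A perturbation parameter `δ` that is small enough for the tail bound. -/
theorem delta_bounds {δ n : ℝ} {d : ℕ} (hd : 0 < d) (hn : 2 ≤ n)
    (hδ : δ ^ 2 ≤ ((2 : ℝ) ^ d)⁻¹ / (10000 * n)) :
    0 < 1 + δ ∧ 2 ^ d * (δ / (1 + δ)) ^ 2 * (9000 * n) ≤ 1 := by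
  have hδle : δ ^ 2 ≤ 1 / 40000 := by
    refine hδ.trans ?_
    have h2d : (2 : ℝ) ≤ 2 ^ d := by
      calc (2 : ℝ) = 2 ^ 1 := (pow_one _).symm
        _ ≤ 2 ^ d := pow_le_pow_right₀ (by norm_num) hd
    rw [inv_eq_one_div, div_div, div_le_div_iff_of_pos_left (by norm_num) (by positivity)
      (by norm_num)]
    nlinarith
  obtain ⟨hδ1, hδ2⟩ := abs_le.1 (abs_le_of_sq_le_sq (a := δ) (b := 1 / 200)
    (by norm_num; linarith) (by norm_num))
  have h1δ : 0 < 1 + δ := by linarith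
  refine ⟨h1δ, ?_⟩
  rw [div_pow]
  -- The loss from dividing by (1 + δ)² is what turns the constant 10000 into 9000.
  have h9 : 0.9 ≤ (1 + δ) ^ 2 := by nlinarith
  have h3 : δ ^ 2 * (2 ^ d * (10000 * n)) ≤ 1 := by
    rw [inv_eq_one_div, div_div, le_div_iff₀ (by positivity)] at hδ
    exact hδ
  calc 2 ^ d * (δ ^ 2 / (1 + δ) ^ 2) * (9000 * n)
      = 0.9 * (δ ^ 2 * (2 ^ d * (10000 * n))) / (1 + δ) ^ 2 := by ring
    _ ≤ 0.9 * 1 / (1 + δ) ^ 2 := by gcongr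
    _ ≤ 1 := by rw [div_le_one (by positivity)]; linarith

/-- A large quotient `n D⁴ / d³` forces the quotient `n D² / d²` to be large. -/
theorem one_le_of_le_quotient {n D d : ℝ} (hd : 0 < d) (hD : 0 < D) (hdn : d ≤ n)
    (hX : 10000 ≤ n * D ^ 4 / d ^ 3) : 1 ≤ n * D ^ 2 / (100 * d ^ 2) := by
  have hn : 0 < n := hd.trans_le hdn
  set N : ℝ := n * D ^ 2 / d ^ 2 with hN
  have hN0 : 0 < N := by positivity
  have h1 : n * D ^ 4 / d ^ 3 = N * (D ^ 2 / d) := by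
    rw [hN]; field_simp
  have h2 : D ^ 2 / d ≤ N := by
    -- This is where d ≤ n enters. Since nD⁴/d³ = N · (D²/d) ≤ N², the quotient `N` is at least 100.
    rw [hN, div_le_div_iff₀ hd (by positivity)]
    calc D ^ 2 * d ^ 2 = D ^ 2 * d * d := by ring
      _ ≤ D ^ 2 * d * n := by gcongr
      _ = _ := by ring
  have h3 : 10000 ≤ N * N := by
    calc (10000 : ℝ) ≤ N * (D ^ 2 / d) := h1 ▸ hX
      _ ≤ N * N := by gcongr
  have h4 : n * D ^ 2 / (100 * d ^ 2) = N / 100 := by rw [hN]; field_simp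
  rw [h4]
  nlinarith

/-- Taking logarithms costs 4 log 2 for the factor 0.08, which is at most 4/13 of log X as X ≥ 2^13.
Since log 8 < 2.1, the constant 0.2 leaves room. -/
theorem log_le_of_le_eight_pow {X : ℝ} {t : ℕ} (hX : 10000 ≤ X) (h : 0.08 * X ≤ 8 ^ t) :
    0.2 * Real.log X ≤ t := by
  have hX0 : 0 < X := by linarith
  have hlog := Real.log_le_log (by positivity) h
  rw [Real.log_pow, Real.log_mul (by norm_num) (by positivity)] at hlog
  have l2 := Real.log_two_gt_d9
  have l2' := Real.log_two_lt_d9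
  have hl8 : Real.log 8 = 3 * Real.log 2 := by
    rw [show (8 : ℝ) = 2 ^ 3 by norm_num, Real.log_pow]; norm_num
  have hl008 : -(4 * Real.log 2) ≤ Real.log 0.08 := by
    rw [show (4 : ℝ) = ((4 : ℕ) : ℝ) by norm_num, ← Real.log_pow, ← Real.log_inv]
    exact Real.log_le_log (by norm_num) (by norm_num)
  have hlX : 13 * Real.log 2 ≤ Real.log X := by
    rw [show (13 : ℝ) = ((13 : ℕ) : ℝ) by norm_num, ← Real.log_pow]
    exact Real.log_le_log (by norm_num) (by linarith)
  rw [hl8] at hlog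
  have ht : (t : ℝ) * (3 * Real.log 2) ≤ t * 2.1 := by gcongr; linarith
  linarith

end Main

end TannerNLTS

/-! ### Assembly of the estimates -/

open TannerNLTS in
theorem theorem5 :
    ∃ c : ℝ, 0 < c ∧ ∃ X₀ : ℝ,
      ∀ (n d k₀ Δ₀ : ℕ) (G : SimpleGraph (Fin n)) [DecidableRel G.Adj]
        (hG : G.IsRegularOfDegree d) (num : EdgeNumbering G)
        (C : Submodule Bit (Fin d → Bit)) (δ ε : ℝ)
        (E₁ : Finset G.edgeSet) (a : ℕ)
        (U : Circuit (Qubit G ⊕ Fin a)) (Γ : (Qubit G ⊕ Fin a → Bit) → ℂ),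
        0 < d →
        Module.finrank Bit C = k₀ →
        codeDist C = Δ₀ →
        (0.55 : ℝ) * d ≤ k₀ →
        4 * secondEigenvalue G ≤ Δ₀ →
        δ ≠ 0 →
        δ ^ 2 ≤ ((2 : ℝ) ^ d)⁻¹ / (10000 * n) →
        ε ≤ 1 / (20000 * (d : ℝ) ^ 2) →
        ε ≤ (Δ₀ : ℝ) ^ 2 / (300 * (d : ℝ) ^ 4) →
        (E₁ᶜ.card : ℝ) ≤ ε * Fintype.card G.edgeSet →
        IsGroundState (hamiltonian num hG C δ E₁) Γ →
        traceDist Γ (Circuit.output U) ≤ 0.1 →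
        X₀ ≤ n * (Δ₀ : ℝ) ^ 4 / (d : ℝ) ^ 3 →
        c * Real.log (n * (Δ₀ : ℝ) ^ 4 / (d : ℝ) ^ 3) ≤ Circuit.depth U := by
  -- The value 10000 makes the violation threshold nΔ₀²/(100d²) at least 1.
  refine ⟨0.2, by norm_num, 10000, ?_⟩
  intro n d k₀ Δ₀ G _ hG num C δ ε E₁ a U Γ hd hk₀ hΔ₀ hrate hl hδ0 hδ hε1 hε2 hE₁ hΓ hdist hX
  have hd1 : (1 : ℝ) ≤ d := by exact_mod_cast hd
  have hd0 : (0 : ℝ) < d := by linarith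
  have hX0 : 0 < (n : ℝ) * (Δ₀ : ℝ) ^ 4 / (d : ℝ) ^ 3 := by linarith
  have hnpos : 0 < n := by
    rcases Nat.eq_zero_or_pos n with rfl | h
    · simp at hX0
    · exact h
  have hdn : d < n := by
    have := G.degree_lt_card_verts ⟨0, hnpos⟩
    rwa [hG, Fintype.card_fin] at this
  have hn2 : 2 ≤ Fintype.card (Fin n) := by rw [Fintype.card_fin]; omega
  have hn0 : (0 : ℝ) < n := by exact_mod_cast hnpos
  have hn2' : (2 : ℝ) ≤ n := by exact_mod_cast (by omega : 2 ≤ n)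
  have hC : C ≠ ⊥ := by
    rintro rfl
    rw [finrank_bot] at hk₀
    subst hk₀
    norm_num at hrate
    linarith
  have hdn' : (d : ℝ) ≤ n := by exact_mod_cast hdn.le
  have hDd : (Δ₀ : ℝ) ≤ d := by rw [← hΔ₀]; exact_mod_cast codeDist_le hC
  have hD0 : (0 : ℝ) < Δ₀ := by rw [← hΔ₀]; exact_mod_cast codeDist_pos hC
  obtain ⟨h1δ, hα⟩ := delta_bounds hd hn2' hδ
  have hα0 : 0 < (δ / (1 + δ)) ^ 2 := by positivity
  -- the number of removed edges
  have hEcard : (2 : ℝ) * Fintype.card G.edgeSet = n * d := by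
    have := two_mul_card_edgeSet hG
    rw [Fintype.card_fin] at this
    exact_mod_cast this
  have hEc : (2 * E₁ᶜ.card : ℝ) ≤ ε * (n * d) := by
    rw [← hEcard]; linarith
  have hE2 : (2 * E₁ᶜ.card : ℝ) ≤ n * (Δ₀ : ℝ) ^ 2 / (300 * (d : ℝ) ^ 3) := by
    calc (2 * E₁ᶜ.card : ℝ) ≤ ε * (n * d) := hEc
      _ ≤ (Δ₀ : ℝ) ^ 2 / (300 * (d : ℝ) ^ 4) * (n * d) := by gcongr
      _ = _ := by field_simp
  have hE3 : (2 * E₁ᶜ.card : ℝ) ≤ n * d / 20000 := by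
    calc (2 * E₁ᶜ.card : ℝ) ≤ ε * (n * d) := hEc
      _ ≤ 1 / (20000 * (d : ℝ) ^ 2) * (n * d) := by gcongr
      _ ≤ 1 / (20000 * 1) * (n * d) := by
          gcongr
          exact one_le_pow₀ hd1
      _ = _ := by ring
  -- a nonzero word of the Tanner code
  obtain ⟨k, hk, hk0⟩ : ∃ k ∈ tannerCode num hG C E₁, k ≠ 0 := by
    apply exists_mem_tannerCode_ne_zero
    have h1 : k₀ ≤ d := by
      rw [← hk₀]
      exact (Submodule.finrank_le C).trans (by simp)
    rw [Fintype.card_fin, hk₀]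
    have h2 : (E₁.card : ℝ) + E₁ᶜ.card = Fintype.card G.edgeSet := by
      exact_mod_cast Finset.card_add_card_compl E₁
    -- There are at most 0.45 nd parity checks, and at least nd/2 - nd/40000 edges remain.
    have h3 : ((n * (d - k₀) : ℕ) : ℝ) < E₁.card := by
      rw [Nat.cast_mul, Nat.cast_sub h1]
      have h4 : (0 : ℝ) < n * d := by positivity
      have h5 : (n : ℝ) * (0.55 * d) ≤ n * k₀ := by gcongr
      nlinarith
    exact_mod_cast h3
  -- the threshold for the number of violated vertices
  have hb := one_le_of_le_quotient hd0 hD0 hdn' hX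
  -- the distribution of the outcomes
  obtain ⟨μ, hpμ, hμ0, hμE, hμinv⟩ := hΓ.exists_weight num hG C hδ0 h1δ.ne'
  have hΓ1 : normSq Γ = 1 := by
    have := hΓ.1
    rw [star_dotProduct_self] at this
    exact_mod_cast this
  have hp1 := (sum_sum_elim_eq_normSq Γ).trans hΓ1
  -- With b = nΔ₀²/(100d²), the bound b/(3d) required for the removed edges is exactly nΔ₀²/(300d³),
  -- and 100bd² = nΔ₀² ≥ n.
  have htail := sum_violated_gt_le num hG C (E₁ := E₁)
    (b := n * (Δ₀ : ℝ) ^ 2 / (100 * (d : ℝ) ^ 2)) (by positivity) hpμ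
    hμ0 hμE hμinv hd (by omega) hb
    (hE2.trans (le_of_eq (by field_simp; norm_num)))
    (by
      rw [Fintype.card_fin]
      have h1 : (1 : ℝ) ≤ (Δ₀ : ℝ) ^ 2 := by
        have : (1 : ℝ) ≤ Δ₀ := by exact_mod_cast Nat.cast_pos.1 hD0
        exact one_le_pow₀ this
      calc (n : ℝ) = n * 1 := (mul_one _).symm
        _ ≤ n * (Δ₀ : ℝ) ^ 2 := by gcongr
        _ = _ := by field_simp) hα0 (by rw [Fintype.card_fin]; exact hα)
  rw [hp1, mul_one] at htail
  obtain ⟨A, A', hsep, hA, hA'⟩ := exists_separated_sets num hG hd hn2 hC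
    (by rw [hΔ₀]; exact hl) (by rw [hΔ₀, Fintype.card_fin]; exact hE2) hk hk0
    (p := fun x => ∑ w : Fin a → Bit, ‖Γ (Sum.elim x w)‖ ^ 2) (fun x => by
      rw [hpμ, hpμ, violated_add_of_forall_mem num hG C x k hk.2, hμinv k hk.1])
    (fun x e he hxe => by rw [hpμ, hμE x e he hxe, mul_zero]) hp1
    (by rw [hΔ₀, Fintype.card_fin]; exact htail)
  rw [hΔ₀, Fintype.card_fin] at hsep
  have hfinal := sq_le_card_mul_of_separated U hΓ1 hdist (by positivity) hsep hA hA'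
  rw [card_qubit num hG, Fintype.card_fin] at hfinal
  -- conclusion
  set X : ℝ := n * (Δ₀ : ℝ) ^ 4 / (d : ℝ) ^ 3 with hXdef
  -- 0.175 · 0.68² is slightly more than 0.08; the common factor nd, the number of measured qubits,
  -- cancels.
  have h8 : 0.08 * X ≤ 8 ^ Circuit.depth U := by
    have h1 : (0.68 * (n * (Δ₀ : ℝ) ^ 2 / d)) ^ 2 = 0.4624 * X * (n * d) := by
      rw [hXdef]; field_simp; norm_num
    rw [h1, Nat.cast_mul] at hfinal
    have h2 : (n * d : ℝ) * (0.08 * X) ≤ (n * d : ℝ) * 8 ^ Circuit.depth U := by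
      have : (0 : ℝ) < X * (n * d) := by positivity
      linarith
    exact le_of_mul_le_mul_left h2 (by positivity)
  exact log_le_of_le_eight_pow hX h8
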